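/- Consider the linear model $y = X\beta + \epsilon$ with $n \ge 1$ observations and $p \ge 2$ covariates, where the rows $X_{i\cdot}$ of $X$ are i.i.d. $N_p(0, \Omega^{-1})$ and independent of $\epsilon \sim N_n(0, \sigma^2 \mathrm{I})$. The data are $Z = (Z_1, \dots, Z_n)$ with $Z_i = (y_i, X_{i\cdot})$, and $\mathbb{P}_\theta$, $\mathbb{E}_\theta$ denote probability and expectation under the parameter $\theta = (\beta, \Omega, \sigma)$. For fixed constants $M_1 > 1$ and $M_2 > 0$ let $$\Theta(k) = \Big\{(\beta, \Omega, \sigma) : \|\beta\|_0 \le k,\ \tfrac{1}{M_1} \le \lambda_{\min}(\Omega) \le \lambda_{\max}(\Omega) \le M_1,\ 0 < \sigma \le M_2\Big\},$$ where $\|\beta\|_0$ is the number of nonzero entries of $\beta$ and $\Omega$ ranges over symmetric $p \times p$ matrices. Let $\mathcal{I}_\alpha(\Theta(k), \beta_1)$ be the set of intervals $\mathrm{CI} = [l(Z), u(Z)]$ with $\inf_{\theta \in \Theta(k)} \mathbb{P}_\theta(l(Z) \le \beta_1 \le u(Z)) \ge 1 - \alpha$, and let $L(\mathrm{CI}) =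 u(Z) - l(Z)$. Let $0 < \alpha < \frac12$, $c > 0$, $0 \le \gamma < \frac12$ and $0 < \zeta_0 < 1$ be constants. Then there is a constant $c_1 > 0$, depending only on $\alpha, M_1, M_2, c, \gamma, \zeta_0$, such that for all $n \ge 1$ and $p \ge 2$, all nonnegative integers $k, k_1$ with $k \le c \min\{p^\gamma, \frac{n}{\log p}\}$ and $k_1 \le (1 - \zeta_0) k - 1$, and every $\theta^* = (\beta^*, \mathrm{I}, \sigma) \in \Theta(k_1)$, $$\inf_{\mathrm{CI} \in \mathcal{I}_\alpha(\Theta(k), \beta_1)} \mathbb{E}_{\theta^*} L(\mathrm{CI}) \ \ge\ c_1 \Big(\frac{1}{\sqrt n} + k\, \frac{\log p}{n}\Big) \sigma .$$ -/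

import Mathlib

open MeasureTheory ProbabilityTheory
open scoped ENNReal

noncomputable section

namespace HDRegression

/-- A parameter `θ = (β, Ω, σ)` of the linear model with Gaussian random design: regression
vector, precision matrix of the design, noise level. -/
structure Param (p : ℕ) where
  β : EuclideanSpace ℝ (Fin p)
  Ω : Matrix (Fin p) (Fin p) ℝ
  σ : ℝ

/-- The sparsity-`k` parameter space `Θ(k)` with constants `M₁`, `M₂`: `β` has at most `k` nonzero
entries, `Ω` is symmetric with all its eigenvalues in `[1/M₁, M₁]`, and `0 < σ ≤ M₂`. -/
def paramSpace (p : ℕ) (M₁ M₂ : ℝ) (k : ℕ) : Set (Param p) :=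
  {θ | hammingNorm θ.β.ofLp ≤ k ∧
    (∃ h : θ.Ω.IsHermitian, ∀ i, 1 / M₁ ≤ h.eigenvalues i ∧ h.eigenvalues i ≤ M₁) ∧
    0 < θ.σ ∧ θ.σ ≤ M₂}

/-- One observation `Zᵢ = (yᵢ, Xᵢ)`. -/
abbrev Obs (p : ℕ) : Type := ℝ × EuclideanSpace ℝ (Fin p)

/-- The law of one observation `(y, X)`: `y = Xᵀ β + ε`, where `X ∼ N(0, Ω⁻¹)` and
`ε ∼ N(0, σ²)` are independent. -/
def obsLaw {p : ℕ} (θ : Param p) : Measure (Obs p) :=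
  ((multivariateGaussian 0 θ.Ω⁻¹).prod (gaussianReal 0 (θ.σ ^ 2).toNNReal)).map
    fun w => (inner ℝ w.1 θ.β + w.2, w.1)

/-- The law `ℙ_θ` of the data `Z = (Z₁, …, Zₙ)`, which are `n` i.i.d. observations. -/
def dataLaw (n : ℕ) {p : ℕ} (θ : Param p) : Measure (Fin n → Obs p) :=
  Measure.pi fun _ => obsLaw θ

/-- A data-dependent interval `[l(Z), u(Z)]`. -/
structure RandomInterval (n p : ℕ) where
  l : (Fin n → Obs p) → ℝ
  u : (Fin n → Obs p) → ℝ
  measurable_l : Measurable l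
  measurable_u : Measurable u
  l_le_u : ∀ z, l z ≤ u z

/-- The set of `(1 - α)`-level confidence intervals for `T(β)` over the parameter space `Θ`. -/
def confidenceIntervals (n : ℕ) {p : ℕ} (α : ℝ) (Θ : Set (Param p))
    (T : EuclideanSpace ℝ (Fin p) → ℝ) : Set (RandomInterval n p) :=
  {CI | ENNReal.ofReal (1 - α) ≤
    ⨅ θ ∈ Θ, dataLaw n θ {z | CI.l z ≤ T θ.β ∧ T θ.β ≤ CI.u z}}

/-- The expected length `𝔼_θ (u(Z) - l(Z))`, which is `∞` if the length is not integrable. -/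
def expectedLength {n p : ℕ} (CI : RandomInterval n p) (θ : Param p) : ℝ≥0∞ :=
  ∫⁻ z, ENNReal.ofReal (CI.u z - CI.l z) ∂(dataLaw n θ)

end HDRegression

end

/-! An interval that covers both `β₁*` and another value `b` has length at least `|b - β₁*|`. It
therefore suffices to find parameters in `Θ(k)` whose first coefficient is a common value `b` and
whose uniform mixture of data laws is close to the law at `θ*` in chi-square distance. Coverage at
`b` then persists under `θ*`, up to a loss of `η = (1 - 2α)/2`, and both coverage events hold
together with probability at least `η` (`ofReal_le_expectedLength`).

All the laws used are images, under one common map, of pairs `(u, x)` with `u` correlated at level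
`r` with the coordinate of `x` along a unit vector `w`. For such pairs the chi-square cross term of
directions `w`, `w'` is exactly `1 / (1 - r² ⟨w, w'⟩)` per observation
(`lintegral_corrDensity_inner_mul`), so everything reduces to averaging its `n`-th powers
(`ofReal_le_expectedLength_of_corrLaw`).

The `1/√n` term comes from a single alternative: shift `β₁` by a multiple of `σ/√n`, lowering the
noise so that the variance of the residual `y - Xᵀβ*` is unchanged (`obsLaw_shift`). The `k log p /
n` term comes from a hidden confounder. Let the normalized residual and the first covariate both
have covariance `κ` with the covariate along a random sparse direction `d`, and remain uncorrelated
with each other. Regressing on both covariates then moves `β₁` by `-σκ²/(1 - κ²)`, whatever `d` is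
(`obsLaw_hiddenParam`). Since `d` is unknown and two independent choices rarely overlap, `κ²` of
order `m log p / n` stays undetectable, where `m` is the sparsity of `d`
(`ofReal_le_expectedLength_sparse`).

The condition `γ < 1/2` makes the expected overlap `m²/p` polynomially small once `p` is large. For
bounded `p` the second rate is dominated by `1/√n`. -/

namespace HDRegression

/-! ### One-dimensional Gaussian integrals -/

theorem lintegral_exp_quadratic_gaussianReal (l m : ℝ) (h : -1 < l) :
    ∫⁻ x, ENNReal.ofReal (Real.exp (-l * x ^ 2 / 2 + m * x)) ∂(gaussianReal 0 1) =
      ENNReal.ofReal ((√(1 + l))⁻¹ * Real.exp (m ^ 2 / (2 * (1 + l)))) := by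
  have hl : 0 < 1 + l := by linarith
  set v : NNReal := ((1 + l)⁻¹).toNNReal
  have hv : (v : ℝ) = (1 + l)⁻¹ := Real.coe_toNNReal _ (by positivity)
  have hv0 : v ≠ 0 := (Real.toNNReal_pos.2 (inv_pos.2 hl)).ne'
  rw [gaussianReal_of_var_ne_zero _ one_ne_zero,
    lintegral_withDensity_eq_lintegral_mul _ (measurable_gaussianPDF 0 1) (by fun_prop)]
  have key : ∀ x, (gaussianPDF 0 1 * fun x =>
      ENNReal.ofReal (Real.exp (-l * x ^ 2 / 2 + m * x))) x =
      ENNReal.ofReal ((√(1 + l))⁻¹ * Real.exp (m ^ 2 / (2 * (1 + l)))) *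
        gaussianPDF (m / (1 + l)) v x := by
    intro x
    simp only [Pi.mul_apply, gaussianPDF]
    rw [← ENNReal.ofReal_mul (gaussianPDFReal_nonneg _ _ _), ← ENNReal.ofReal_mul (by positivity)]
    congr 1
    simp only [gaussianPDFReal, hv, NNReal.coe_one]
    have h1 : √(2 * Real.pi * (1 + l)⁻¹) = √(2 * Real.pi) * (√(1 + l))⁻¹ := by
      rw [Real.sqrt_mul (by positivity), Real.sqrt_inv]
    rw [h1, mul_one, mul_assoc, ← Real.exp_add, mul_inv, inv_inv]
    have h2 : (√(1 + l))⁻¹ * Real.exp (m ^ 2 / (2 * (1 + l))) *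
        ((√(2 * Real.pi))⁻¹ * √(1 + l) * Real.exp (-(x - m / (1 + l)) ^ 2 / (2 * (1 + l)⁻¹))) =
        (√(1 + l))⁻¹ * √(1 + l) * ((√(2 * Real.pi))⁻¹ * (Real.exp (m ^ 2 / (2 * (1 + l))) *
          Real.exp (-(x - m / (1 + l)) ^ 2 / (2 * (1 + l)⁻¹)))) := by ring
    rw [h2, inv_mul_cancel₀ (Real.sqrt_pos.2 hl).ne', one_mul, ← Real.exp_add]
    congr 2
    field_simp
    ring
  simp_rw [key]
  rw [lintegral_const_mul _ (measurable_gaussianPDF _ _), lintegral_gaussianPDF_eq_one _ hv0, mul_one]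

/-- The density, with respect to the standard Gaussian measure, of the conditional law of `u`
given `a` when `(u, a)` is a standard Gaussian pair with correlation `r`. -/
noncomputable def corrDensity (r u a : ℝ) : ℝ :=
  (√(1 - r ^ 2))⁻¹ * Real.exp (u ^ 2 / 2 - (u - r * a) ^ 2 / (2 * (1 - r ^ 2)))

theorem corrDensity_nonneg (r u a : ℝ) : 0 ≤ corrDensity r u a := by
  unfold corrDensity; positivity

theorem gaussianReal_eq_withDensity_corrDensity {r : ℝ} (hr : r ^ 2 < 1) (a : ℝ) :
    gaussianReal (r * a) (1 - r ^ 2).toNNReal =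
      (gaussianReal 0 1).withDensity fun u => ENNReal.ofReal (corrDensity r u a) := by
  have h1 : 0 < 1 - r ^ 2 := by linarith
  have hv : (1 - r ^ 2).toNNReal ≠ 0 := (Real.toNNReal_pos.2 h1).ne'
  have hm : Measurable fun u => ENNReal.ofReal (corrDensity r u a) := by
    unfold corrDensity; fun_prop
  rw [gaussianReal_of_var_ne_zero _ hv, gaussianReal_of_var_ne_zero _ one_ne_zero,
    ← withDensity_mul _ (measurable_gaussianPDF 0 1) hm]
  congr 1
  ext u
  simp only [Pi.mul_apply, gaussianPDF]
  rw [← ENNReal.ofReal_mul (gaussianPDFReal_nonneg _ _ _)]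
  congr 1
  simp only [gaussianPDFReal, corrDensity, Real.coe_toNNReal _ h1.le, NNReal.coe_one]
  rw [Real.sqrt_mul (by positivity), mul_inv, mul_one]
  have h2 : (√(2 * Real.pi))⁻¹ * Real.exp (-(u - 0) ^ 2 / (2 * 1)) *
      ((√(1 - r ^ 2))⁻¹ * Real.exp (u ^ 2 / 2 - (u - r * a) ^ 2 / (2 * (1 - r ^ 2)))) =
      (√(2 * Real.pi))⁻¹ * (√(1 - r ^ 2))⁻¹ * (Real.exp (-(u - 0) ^ 2 / (2 * 1)) *
        Real.exp (u ^ 2 / 2 - (u - r * a) ^ 2 / (2 * (1 - r ^ 2)))) := by ring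
  rw [h2, ← Real.exp_add]
  congr 2
  ring

/-- Composing two Gaussian channels of correlation `r` through the shared variable `u` gives one of
correlation `r²`, so the result is the Mehler kernel in `(a, b)` with parameter `r²`. -/
theorem lintegral_corrDensity_mul {r : ℝ} (hr : r ^ 2 < 1) (a b : ℝ) :
    ∫⁻ u, ENNReal.ofReal (corrDensity r u a) * ENNReal.ofReal (corrDensity r u b)
        ∂(gaussianReal 0 1) =
      ENNReal.ofReal ((√(1 - r ^ 4))⁻¹ *
        Real.exp ((2 * r ^ 2 * (a * b) - r ^ 4 * (a ^ 2 + b ^ 2)) / (2 * (1 - r ^ 4)))) := by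
  have h1 : 0 < 1 - r ^ 2 := by linarith
  have h2 : 0 < 1 + r ^ 2 := by positivity
  have h4 : 1 - r ^ 4 = (1 - r ^ 2) * (1 + r ^ 2) := by ring
  have hd : 1 + 2 * r ^ 2 / (1 - r ^ 2) = (1 + r ^ 2) / (1 - r ^ 2) := by field_simp; ring
  have key : ∀ u, ENNReal.ofReal (corrDensity r u a) * ENNReal.ofReal (corrDensity r u b) =
      ENNReal.ofReal ((1 - r ^ 2)⁻¹ * Real.exp (- r ^ 2 * (a ^ 2 + b ^ 2) / (2 * (1 - r ^ 2)))) *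
      ENNReal.ofReal (Real.exp (-(2 * r ^ 2 / (1 - r ^ 2)) * u ^ 2 / 2
        + (r * (a + b) / (1 - r ^ 2)) * u)) := by
    intro u
    rw [← ENNReal.ofReal_mul (corrDensity_nonneg _ _ _), ← ENNReal.ofReal_mul (by positivity)]
    congr 1
    unfold corrDensity
    rw [mul_mul_mul_comm, ← mul_inv, Real.mul_self_sqrt h1.le, ← Real.exp_add, mul_assoc,
      ← Real.exp_add]
    congr 2
    field_simp
    ring
  simp_rw [key]
  rw [lintegral_const_mul _ (by fun_prop),
    lintegral_exp_quadratic_gaussianReal _ _ (by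
      have : 0 ≤ 2 * r ^ 2 / (1 - r ^ 2) := by positivity
      linarith), ← ENNReal.ofReal_mul (by positivity), hd, h4, Real.sqrt_mul h1.le,
    Real.sqrt_div h2.le]
  congr 1
  rw [mul_mul_mul_comm, ← Real.exp_add]
  congr 1
  · have hs := Real.mul_self_sqrt h1.le
    have p1 := Real.sqrt_pos.2 h1
    have p2 := Real.sqrt_pos.2 h2
    field_simp
    rw [sq, hs]
  · congr 1
    field_simp
    ring

/-- The integrand is the Mehler kernel with parameter `s`, averaged over a Gaussian pair of
correlation `ρ`. Its Hermite expansion explains the value as the geometric series `∑ (sρ)^j`; the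
proof completes the square twice. -/
theorem lintegral_lintegral_exp_corr {s ρ : ℝ} (hs : s ^ 2 < 1) (hρ : ρ ^ 2 ≤ 1) :
    ∫⁻ a, ∫⁻ g, ENNReal.ofReal ((√(1 - s ^ 2))⁻¹ *
        Real.exp ((2 * s * (a * (ρ * a + √(1 - ρ ^ 2) * g)) -
          s ^ 2 * (a ^ 2 + (ρ * a + √(1 - ρ ^ 2) * g) ^ 2)) / (2 * (1 - s ^ 2))))
        ∂(gaussianReal 0 1) ∂(gaussianReal 0 1) = ENNReal.ofReal (1 - s * ρ)⁻¹ := by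
  have h1 : 0 < 1 - s ^ 2 := by linarith
  have h2 : 0 ≤ 1 - ρ ^ 2 := by linarith
  have hk := Real.sq_sqrt h2
  set κ := √(1 - ρ ^ 2)
  have hsr : (s * ρ) ^ 2 < 1 := by
    rw [mul_pow]
    nlinarith [sq_nonneg s, sq_nonneg ρ]
  have habs := abs_lt.1 ((sq_lt_one_iff_abs_lt_one _).1 hsr)
  have h3 : 0 < 1 - s * ρ := by linarith [habs.2]
  have h4 : 0 < 1 + s * ρ := by linarith [habs.1]
  have hl1 : 1 + s ^ 2 * κ ^ 2 / (1 - s ^ 2) = (1 - s * ρ) * (1 + s * ρ) / (1 - s ^ 2) := by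
    rw [hk]; field_simp; ring
  have inner : ∀ a, ∫⁻ g, ENNReal.ofReal ((√(1 - s ^ 2))⁻¹ *
        Real.exp ((2 * s * (a * (ρ * a + κ * g)) -
          s ^ 2 * (a ^ 2 + (ρ * a + κ * g) ^ 2)) / (2 * (1 - s ^ 2)))) ∂(gaussianReal 0 1) =
      ENNReal.ofReal (√((1 - s * ρ) * (1 + s * ρ)))⁻¹ *
        ENNReal.ofReal (Real.exp (-(-2 * (s * ρ) / (1 + s * ρ)) * a ^ 2 / 2 + 0 * a)) := by
    intro a
    have key : ∀ g, ENNReal.ofReal ((√(1 - s ^ 2))⁻¹ *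
        Real.exp ((2 * s * (a * (ρ * a + κ * g)) -
          s ^ 2 * (a ^ 2 + (ρ * a + κ * g) ^ 2)) / (2 * (1 - s ^ 2)))) =
        ENNReal.ofReal ((√(1 - s ^ 2))⁻¹ *
          Real.exp (a ^ 2 * (2 * s * ρ - s ^ 2 - s ^ 2 * ρ ^ 2) / (2 * (1 - s ^ 2)))) *
        ENNReal.ofReal (Real.exp (-(s ^ 2 * κ ^ 2 / (1 - s ^ 2)) * g ^ 2 / 2
          + (s * κ * (1 - s * ρ) * a / (1 - s ^ 2)) * g)) := by
      intro g
      rw [← ENNReal.ofReal_mul (by positivity), mul_assoc (√(1 - s ^ 2))⁻¹ (Real.exp _),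
        ← Real.exp_add]
      congr 3
      field_simp
      ring
    simp_rw [key]
    rw [lintegral_const_mul _ (by fun_prop),
      lintegral_exp_quadratic_gaussianReal _ _ (by
        have : 0 ≤ s ^ 2 * κ ^ 2 / (1 - s ^ 2) := by positivity
        linarith), ← ENNReal.ofReal_mul (by positivity), ← ENNReal.ofReal_mul (by positivity),
      hl1, Real.sqrt_div (by positivity), mul_mul_mul_comm, ← Real.exp_add]
    congr 1
    congr 1
    · have p1 := Real.sqrt_pos.2 h1
      field_simp
    · congr 1
      have e1 : (s * κ * (1 - s * ρ) * a / (1 - s ^ 2)) ^ 2 =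
          s ^ 2 * (1 - ρ ^ 2) * (1 - s * ρ) ^ 2 * a ^ 2 / (1 - s ^ 2) ^ 2 := by
        rw [← hk]; field_simp
      rw [e1]
      field_simp
      ring
  simp_rw [inner]
  have hl2 : 1 + (-2 * (s * ρ) / (1 + s * ρ)) = (1 - s * ρ) / (1 + s * ρ) := by field_simp; ring
  rw [lintegral_const_mul _ (by fun_prop),
    lintegral_exp_quadratic_gaussianReal _ _ (by
      have : 0 < (1 - s * ρ) / (1 + s * ρ) := by positivity
      linarith), hl2, ← ENNReal.ofReal_mul (by positivity)]
  congr 1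
  rw [Real.sqrt_div h3.le, Real.sqrt_mul h3.le]
  have p3 := Real.sqrt_pos.2 h3
  have p4 := Real.sqrt_pos.2 h4
  have q3 := Real.sq_sqrt h3.le
  simp only [ne_eq, OfNat.ofNat_ne_zero, not_false_eq_true, zero_pow, zero_div, Real.exp_zero,
    mul_one]
  field_simp
  rw [q3]

/-! ### Correlated Gaussian pairs and their densities -/

section ProductLaws

set_option linter.unusedSectionVars false

variable {F : Type*} [NormedAddCommGroup F] [InnerProductSpace ℝ F] [FiniteDimensional ℝ F]
  [MeasurableSpace F] [BorelSpace F]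

/-- The Fourier transform of a measure on `ℝ × F`, as a function of two frequencies. -/
noncomputable def charFunPair (μ : Measure (ℝ × F)) (s : ℝ) (t : F) : ℂ :=
  ∫ z, Complex.exp (((s * z.1 + inner ℝ z.2 t : ℝ) : ℂ) * Complex.I) ∂μ

/-- The sup norm on `ℝ × F` is not an inner product norm, so frequencies are functionals `L`. Each
splits into the scalar `L (1, 0)` and the Riesz vector of its restriction to `F`. -/
theorem ext_of_charFunPair {μ ν : Measure (ℝ × F)} [IsFiniteMeasure μ] [IsFiniteMeasure ν]
    (h : ∀ s t, charFunPair μ s t = charFunPair ν s t) : μ = ν := by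
  have : CompleteSpace F := FiniteDimensional.complete ℝ F
  refine Measure.ext_of_charFunDual ?_
  ext L
  have key : ∀ z : ℝ × F, L z = L (1, 0) * z.1 + inner ℝ z.2
      ((InnerProductSpace.toDual ℝ F).symm (L.comp (ContinuousLinearMap.inr ℝ ℝ F))) := by
    intro z
    rw [real_inner_comm, InnerProductSpace.toDual_symm_apply]
    simp only [ContinuousLinearMap.comp_apply, ContinuousLinearMap.inr_apply]
    have : z = z.1 • ((1 : ℝ), (0 : F)) + (0, z.2) := by ext <;> simp
    conv_lhs => rw [this, map_add, map_smul, smul_eq_mul]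
    ring
  have h' := h (L (1, 0))
    ((InnerProductSpace.toDual ℝ F).symm (L.comp (ContinuousLinearMap.inr ℝ ℝ F)))
  simp only [charFunPair, ← key] at h'
  exact h'

theorem charFunPair_prod (μ : Measure ℝ) (ν : Measure F) [SFinite μ] [SFinite ν] (s : ℝ) (t : F) :
    charFunPair (μ.prod ν) s t = charFun μ s * charFun ν t := by
  unfold charFunPair
  rw [charFun_apply, charFun_apply, ← integral_prod_mul]
  congr 1 with z
  rw [← Complex.exp_add]
  congr 1
  simp only [RCLike.inner_apply, conj_trivial, Complex.ofReal_add, Complex.ofReal_mul]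
  ring

variable (F) in
/-- The law of an independent pair of standard Gaussian vectors in `ℝ` and `F`. -/
noncomputable def stdPair : Measure (ℝ × F) := (gaussianReal 0 1).prod (stdGaussian F)

instance : IsProbabilityMeasure (stdPair F) := by unfold stdPair; infer_instance

theorem charFunPair_stdPair (s : ℝ) (t : F) :
    charFunPair (stdPair F) s t = Complex.exp ((-(s ^ 2 + ‖t‖ ^ 2) / 2 : ℝ) : ℂ) := by
  rw [stdPair, charFunPair_prod, charFun_gaussianReal, charFun_stdGaussian, ← Complex.exp_add]
  congr 1
  push_cast
  simp
  ring

/-- Law of `(u, x)` with `u` a standard Gaussian variable, `x` a standard Gaussian vector and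
correlation `r` between `u` and the coordinate of `x` along `w`. -/
noncomputable def corrLaw (r : ℝ) (w : F) : Measure (ℝ × F) :=
  (stdPair F).map fun z => (r * inner ℝ w z.2 + √(1 - r ^ 2) * z.1, z.2)

instance (r : ℝ) (w : F) : IsProbabilityMeasure (corrLaw r w) :=
  Measure.isProbabilityMeasure_map (by fun_prop)

theorem corrLaw_zero (w : F) : corrLaw 0 w = stdPair F := by
  simp [corrLaw]

theorem charFunPair_corrLaw {r : ℝ} (hr : r ^ 2 ≤ 1) (w : F) (s : ℝ) (t : F) :
    charFunPair (corrLaw r w) s t =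
      Complex.exp ((-(s ^ 2 * (1 - r ^ 2) + ‖t + (s * r) • w‖ ^ 2) / 2 : ℝ) : ℂ) := by
  have h := charFunPair_stdPair (F := F) (s * √(1 - r ^ 2)) (t + (s * r) • w)
  rw [mul_pow, Real.sq_sqrt (by linarith)] at h
  rw [← h, charFunPair, charFunPair, corrLaw, integral_map (by fun_prop) (by fun_prop)]
  congr 1 with z
  congr 3
  simp only [inner_add_right, real_inner_smul_right, real_inner_comm w z.2]
  ring

theorem measurable_corrDensity_inner (r : ℝ) (w : F) :
    Measurable fun z : ℝ × F => ENNReal.ofReal (corrDensity r z.1 (inner ℝ w z.2)) := by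
  unfold corrDensity; fun_prop

theorem corrLaw_eq_withDensity {r : ℝ} (hr : r ^ 2 < 1) (w : F) :
    corrLaw r w =
      (stdPair F).withDensity fun z => ENNReal.ofReal (corrDensity r z.1 (inner ℝ w z.2)) := by
  have hm := measurable_corrDensity_inner r w
  refine Measure.ext_of_lintegral _ fun f hf => ?_
  rw [corrLaw, lintegral_map hf (by fun_prop), lintegral_withDensity_eq_lintegral_mul _ hm hf,
    stdPair, lintegral_prod_symm _ (by fun_prop), lintegral_prod_symm _ (by fun_prop)]
  refine lintegral_congr fun x => ?_
  have hd : Measurable fun u => ENNReal.ofReal (corrDensity r u (inner ℝ w x)) := by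
    unfold corrDensity; fun_prop
  have hfx : Measurable fun u => f (u, x) := by fun_prop
  -- Conditionally on `x`, the first component is Gaussian with mean `r ⟨w, x⟩` and variance `1 -
  -- r²`.
  have hmap : (gaussianReal 0 1).map (fun g => r * inner ℝ w x + √(1 - r ^ 2) * g) =
      gaussianReal (r * inner ℝ w x) (1 - r ^ 2).toNNReal := by
    have : (fun g => r * inner ℝ w x + √(1 - r ^ 2) * g) =
        (fun g => r * inner ℝ w x + g) ∘ (fun g => √(1 - r ^ 2) * g) := rfl
    rw [this, ← Measure.map_map (by fun_prop) (by fun_prop), gaussianReal_map_const_mul,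
      gaussianReal_map_const_add]
    congr 1
    · ring
    · ext
      simp [Real.sq_sqrt (show 0 ≤ 1 - r ^ 2 by linarith), Real.coe_toNNReal _ (show 0 ≤ 1 - r ^ 2 by linarith)]
  rw [← lintegral_map (f := fun u => f (u, x)) hfx (by fun_prop), hmap,
    gaussianReal_eq_withDensity_corrDensity hr, lintegral_withDensity_eq_lintegral_mul _ hd hfx]
  rfl

theorem map_inner_stdGaussian {w w' : F} (hw : ‖w‖ = 1) (hw' : ‖w'‖ = 1) :
    (stdGaussian F).map (fun x => (inner ℝ w x, inner ℝ w' x)) =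
      ((gaussianReal 0 1).prod (gaussianReal 0 1)).map
        fun z => (z.1, inner ℝ w w' * z.1 + √(1 - inner ℝ w w' ^ 2) * z.2) := by
  have hρ : (inner ℝ w w' : ℝ) ^ 2 ≤ 1 := by
    have := abs_real_inner_le_norm w w'
    rw [hw, hw', mul_one] at this
    exact (sq_le_one_iff_abs_le_one _).2 this
  have : IsProbabilityMeasure ((stdGaussian F).map (fun x => (inner ℝ w x, inner ℝ w' x))) :=
    Measure.isProbabilityMeasure_map (by fun_prop)
  refine ext_of_charFunPair fun s t => ?_
  rw [charFunPair, charFunPair, integral_map (by fun_prop) (by fun_prop),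
    integral_map (by fun_prop) (by fun_prop)]
  have h1 := charFun_stdGaussian (s • w + t • w')
  have h2 := charFunPair_prod (gaussianReal 0 1) (gaussianReal 0 1)
    (s + inner ℝ w w' * t) (√(1 - inner ℝ w w' ^ 2) * t)
  rw [charFun_gaussianReal, charFun_gaussianReal, ← Complex.exp_add] at h2
  rw [charFun_apply] at h1
  rw [charFunPair] at h2
  trans Complex.exp (-‖s • w + t • w'‖ ^ 2 / 2)
  · rw [← h1]
    congr 1 with x
    congr 3
    simp only [inner_add_right, real_inner_smul_right, real_inner_comm w x, real_inner_comm w' x,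
      RCLike.inner_apply, conj_trivial]
  · trans Complex.exp ((-((s + inner ℝ w w' * t) ^ 2 + (√(1 - inner ℝ w w' ^ 2) * t) ^ 2) / 2 : ℝ) : ℂ)
    · rw [← Complex.ofReal_pow, mul_pow, Real.sq_sqrt (by linarith), norm_add_sq_real, norm_smul,
        norm_smul, hw, hw', real_inner_smul_left, real_inner_smul_right]
      simp only [mul_one, Real.norm_eq_abs, sq_abs]
      push_cast
      congr 1
      ring
    · trans Complex.exp (((s + inner ℝ w w' * t : ℝ) : ℂ) * (0 : ℝ) * Complex.I - (1 : NNReal) * ((s + inner ℝ w w' * t : ℝ) : ℂ) ^ 2 / 2 +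
          (((√(1 - inner ℝ w w' ^ 2) * t : ℝ) : ℂ) * (0 : ℝ) * Complex.I - (1 : NNReal) * ((√(1 - inner ℝ w w' ^ 2) * t : ℝ) : ℂ) ^ 2 / 2))
      · congr 1
        push_cast
        ring
      · rw [← h2]
        congr 1 with x
        congr 3
        simp only [RCLike.inner_apply, conj_trivial]
        ring

/-- Integrating out `u` leaves a function of the two coordinates `⟨w, x⟩` and `⟨w', x⟩`, a Gaussian
pair of correlation `⟨w, w'⟩`, to which the Mehler identity applies with `s = r²`. -/
theorem lintegral_corrDensity_inner_mul {r : ℝ} (hr : r ^ 2 < 1) {w w' : F} (hw : ‖w‖ = 1)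
    (hw' : ‖w'‖ = 1) :
    ∫⁻ z, ENNReal.ofReal (corrDensity r z.1 (inner ℝ w z.2)) *
        ENNReal.ofReal (corrDensity r z.1 (inner ℝ w' z.2)) ∂(stdPair F) =
      ENNReal.ofReal (1 - r ^ 2 * inner ℝ w w')⁻¹ := by
  have hρ : (inner ℝ w w' : ℝ) ^ 2 ≤ 1 := by
    have := abs_real_inner_le_norm w w'
    rw [hw, hw', mul_one] at this
    exact (sq_le_one_iff_abs_le_one _).2 this
  have hs : (r ^ 2) ^ 2 < 1 := by nlinarith [sq_nonneg r]
  have hm : Measurable fun z : ℝ × F => ENNReal.ofReal (corrDensity r z.1 (inner ℝ w z.2)) *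
      ENNReal.ofReal (corrDensity r z.1 (inner ℝ w' z.2)) :=
    (measurable_corrDensity_inner r w).mul (measurable_corrDensity_inner r w')
  rw [stdPair, lintegral_prod_symm _ hm.aemeasurable]
  simp only
  simp_rw [lintegral_corrDensity_mul hr]
  rw [← lintegral_map (f := fun q : ℝ × ℝ => ENNReal.ofReal ((√(1 - r ^ 4))⁻¹ *
        Real.exp ((2 * r ^ 2 * (q.1 * q.2) - r ^ 4 * (q.1 ^ 2 + q.2 ^ 2)) / (2 * (1 - r ^ 4)))))
      (g := fun x => (inner ℝ w x, inner ℝ w' x)) (by fun_prop) (by fun_prop),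
    map_inner_stdGaussian hw hw', lintegral_map (by fun_prop) (by fun_prop),
    lintegral_prod _ (by fun_prop), ← lintegral_lintegral_exp_corr hs hρ]
  simp only [← pow_mul]

end ProductLaws

/-! ### Product densities and the chi-square change of measure -/

theorem lintegral_pi_prod_eq_prod {ι Y : Type*} [Fintype ι] [MeasurableSpace Y] (μ : Measure Y)
    [IsProbabilityMeasure μ] (f : ι → Y → ℝ≥0∞) (hf : ∀ i, Measurable (f i)) :
    ∫⁻ z, ∏ i, f i (z i) ∂(Measure.pi fun _ : ι => μ) = ∏ i, ∫⁻ y, f i y ∂μ := by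
  have hind : iIndepFun (fun i (z : ι → Y) => f i (z i)) (Measure.pi fun _ : ι => μ) :=
    iIndepFun_pi fun i => (hf i).aemeasurable
  rw [lintegral_prod_eq_prod_lintegral_of_indepFun Finset.univ _ hind
    fun i => (hf i).comp (measurable_pi_apply i)]
  refine Finset.prod_congr rfl fun i _ => ?_
  exact (measurePreserving_eval (fun _ : ι => μ) i).lintegral_comp (hf i)

theorem pi_withDensity_eq {ι Y : Type*} [Fintype ι] [MeasurableSpace Y] (μ : Measure Y)
    [IsProbabilityMeasure μ] (f : Y → ℝ≥0∞) (hf : Measurable f)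
    [IsProbabilityMeasure (μ.withDensity f)] :
    (Measure.pi fun _ : ι => μ.withDensity f) =
      (Measure.pi fun _ : ι => μ).withDensity fun z => ∏ i, f (z i) := by
  refine Measure.pi_eq fun s hs => ?_
  rw [withDensity_apply _ (MeasurableSet.univ_pi hs),
    ← lintegral_indicator (MeasurableSet.univ_pi hs)]
  have : ∀ z : ι → Y, (Set.univ.pi s).indicator (fun z => ∏ i, f (z i)) z =
      ∏ i, (s i).indicator f (z i) := by
    intro z
    by_cases hz : z ∈ Set.univ.pi s
    · rw [Set.indicator_of_mem hz]
      exact Finset.prod_congr rfl fun i _ => (Set.indicator_of_mem (hz i trivial) f).symm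
    · rw [Set.indicator_of_notMem hz]
      simp only [Set.mem_pi, Set.mem_univ, forall_const, not_forall] at hz
      obtain ⟨i, hi⟩ := hz
      exact (Finset.prod_eq_zero (Finset.mem_univ i) (Set.indicator_of_notMem hi f)).symm
  simp_rw [this]
  rw [lintegral_pi_prod_eq_prod μ _ fun i => hf.indicator (hs i)]
  refine Finset.prod_congr rfl fun i _ => ?_
  rw [lintegral_indicator (hs i), withDensity_apply _ (hs i)]

/-- Chi-square bound on the probability of an event under a change of measure. -/
theorem setLIntegral_le_add_of_chiSq {Y : Type*} [MeasurableSpace Y] (Q : Measure Y)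
    [IsProbabilityMeasure Q] (L : Y → ℝ≥0∞) (hL : Measurable L) {η : ℝ} (hη : 0 < η)
    (h1 : ∫⁻ z, L z ∂Q = 1) (h2 : ∫⁻ z, L z * L z ∂Q ≤ ENNReal.ofReal (1 + η ^ 2))
    {A : Set Y} (hA : MeasurableSet A) :
    ∫⁻ z in A, L z ∂Q ≤ Q A + ENNReal.ofReal η := by
  -- This is `1_A (L - 1) ≤ (L - 1)² / (2η) + η / 2` with the negative terms moved across, as
  -- subtraction truncates in `ℝ≥0∞`. Integrating bounds the right side by `η / 2 + η / 2`.
  have pt : ∀ z, A.indicator L z + ENNReal.ofReal η⁻¹ * L z ≤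
      A.indicator 1 z + ENNReal.ofReal ((2 * η)⁻¹) * (L z * L z) +
        ENNReal.ofReal ((2 * η)⁻¹ + η / 2) := by
    intro z
    by_cases hz : L z = ∞
    · have : ENNReal.ofReal ((2 * η)⁻¹) * (L z * L z) = ∞ := by
        rw [hz, ENNReal.top_mul_top]
        exact ENNReal.mul_top (by simpa using hη)
      rw [this]
      simp
    · obtain ⟨x, hx0, hx⟩ : ∃ x : ℝ, 0 ≤ x ∧ L z = ENNReal.ofReal x :=
        ⟨(L z).toReal, ENNReal.toReal_nonneg, (ENNReal.ofReal_toReal hz).symm⟩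
      have key : 0 ≤ (x - 1 - η) ^ 2 / (2 * η) := by positivity
      have key2 : 0 ≤ ((x - 1) ^ 2 + η ^ 2) / (2 * η) := by positivity
      have e1 : (x - 1 - η) ^ 2 / (2 * η) =
          1 + (2 * η)⁻¹ * (x * x) + ((2 * η)⁻¹ + η / 2) - (x + η⁻¹ * x) := by
        field_simp; ring
      have e2 : ((x - 1) ^ 2 + η ^ 2) / (2 * η) =
          (2 * η)⁻¹ * (x * x) + ((2 * η)⁻¹ + η / 2) - η⁻¹ * x := by
        field_simp; ring
      by_cases hzA : z ∈ A
      · rw [Set.indicator_of_mem hzA, Set.indicator_of_mem hzA, hx, Pi.one_apply,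
          ← ENNReal.ofReal_one, ← ENNReal.ofReal_mul hx0, ← ENNReal.ofReal_mul (by positivity),
          ← ENNReal.ofReal_mul (by positivity), ← ENNReal.ofReal_add hx0 (by positivity),
          ← ENNReal.ofReal_add (by positivity) (by positivity),
          ← ENNReal.ofReal_add (by positivity) (by positivity)]
        exact ENNReal.ofReal_le_ofReal (by linarith)
      · rw [Set.indicator_of_notMem hzA, Set.indicator_of_notMem hzA, hx, zero_add, zero_add,
          ← ENNReal.ofReal_mul hx0, ← ENNReal.ofReal_mul (by positivity),
          ← ENNReal.ofReal_mul (by positivity),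
          ← ENNReal.ofReal_add (by positivity) (by positivity)]
        exact ENNReal.ofReal_le_ofReal (by linarith)
  have hi := lintegral_mono (μ := Q) pt
  rw [lintegral_add_right _ (by fun_prop), lintegral_const_mul _ hL, h1,
    lintegral_add_right _ (by fun_prop), lintegral_add_right _ (by fun_prop),
    lintegral_const_mul _ (by fun_prop), lintegral_indicator hA, lintegral_indicator_one hA,
    lintegral_const, measure_univ, mul_one, mul_one] at hi
  have h3 : ENNReal.ofReal ((2 * η)⁻¹) * ∫⁻ z, L z * L z ∂Q +
      ENNReal.ofReal ((2 * η)⁻¹ + η / 2) ≤ ENNReal.ofReal η⁻¹ + ENNReal.ofReal η := by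
    calc _ ≤ ENNReal.ofReal ((2 * η)⁻¹) * ENNReal.ofReal (1 + η ^ 2) +
        ENNReal.ofReal ((2 * η)⁻¹ + η / 2) := by gcongr
      _ = ENNReal.ofReal η⁻¹ + ENNReal.ofReal η := by
        rw [← ENNReal.ofReal_mul (by positivity), ← ENNReal.ofReal_add (by positivity)
          (by positivity), ← ENNReal.ofReal_add (by positivity) (by positivity)]
        congr 1
        field_simp
        ring
  have h4 : ∫⁻ z in A, L z ∂Q + ENNReal.ofReal η⁻¹ ≤
      (Q A + ENNReal.ofReal η) + ENNReal.ofReal η⁻¹ := by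
    refine hi.trans ?_
    rw [add_assoc, add_assoc, add_comm (ENNReal.ofReal η)]
    gcongr
  exact (ENNReal.add_le_add_iff_right ENNReal.ofReal_ne_top).1 h4

/-- If an event has probability at least `a` under every member of a finite family of densities
whose uniform mixture is chi-square close to `Q`, it has probability at least `a - η` under `Q`. -/
theorem le_measure_add_of_mixture_chiSq {Y D : Type*} [MeasurableSpace Y] [Fintype D] [Nonempty D]
    (Q : Measure Y) [IsProbabilityMeasure Q] (L : D → Y → ℝ≥0∞) (hL : ∀ d, Measurable (L d))
    (h1 : ∀ d, ∫⁻ z, L d z ∂Q = 1) {η : ℝ} (hη : 0 < η)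
    (h2 : ∑ d, ∑ d', ∫⁻ z, L d z * L d' z ∂Q ≤
      ENNReal.ofReal (1 + η ^ 2) * (Fintype.card D : ℝ≥0∞) ^ 2)
    {A : Set Y} (hA : MeasurableSet A) {a : ℝ≥0∞}
    (ha : ∀ d, a ≤ Q.withDensity (L d) A) :
    a ≤ Q A + ENNReal.ofReal η := by
  set N : ℝ≥0∞ := (Fintype.card D : ℝ≥0∞) with hN
  have hN0 : N ≠ 0 := by simp [hN]
  have hNt : N ≠ ∞ := ENNReal.natCast_ne_top _
  have hNN : N⁻¹ * N = 1 := ENNReal.inv_mul_cancel hN0 hNt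
  have key := setLIntegral_le_add_of_chiSq Q (fun z => N⁻¹ * ∑ d, L d z) (by fun_prop) hη ?_ ?_ hA
  · refine le_trans ?_ key
    rw [lintegral_const_mul _ (by fun_prop), lintegral_finsetSum _ fun d _ => hL d]
    have : N * a ≤ ∑ d, ∫⁻ z in A, L d z ∂Q := by
      calc N * a = ∑ _d : D, a := by simp [hN]
        _ ≤ _ := Finset.sum_le_sum fun d _ => by
          rw [← withDensity_apply _ hA]; exact ha d
    calc a = N⁻¹ * (N * a) := by rw [← mul_assoc, hNN, one_mul]
      _ ≤ _ := by gcongr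
  · rw [lintegral_const_mul _ (by fun_prop), lintegral_finsetSum _ fun d _ => hL d]
    simp only [h1, Finset.sum_const, Finset.card_univ, nsmul_eq_mul, mul_one]
    exact hNN
  · have e : ∀ z, (N⁻¹ * ∑ d, L d z) * (N⁻¹ * ∑ d, L d z) =
        (N⁻¹ * N⁻¹) * ∑ d, ∑ d', L d z * L d' z := by
      intro z
      rw [mul_mul_mul_comm, Finset.sum_mul_sum]
    simp_rw [e]
    rw [lintegral_const_mul _ (by fun_prop), lintegral_finsetSum _ fun d _ => by fun_prop]
    have e2 : ∑ d, ∫⁻ z, ∑ d', L d z * L d' z ∂Q = ∑ d, ∑ d', ∫⁻ z, L d z * L d' z ∂Q :=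
      Finset.sum_congr rfl fun d _ => lintegral_finsetSum _ fun d' _ => by fun_prop
    rw [e2]
    calc _ ≤ (N⁻¹ * N⁻¹) * (ENNReal.ofReal (1 + η ^ 2) * N ^ 2) := by gcongr
      _ = ENNReal.ofReal (1 + η ^ 2) * ((N⁻¹ * N) * (N⁻¹ * N)) := by ring
      _ = _ := by rw [hNN]; simp

/-! ### From indistinguishability to expected length -/

theorem ofReal_le_expectedLength {n p : ℕ} {α : ℝ} (hα : α < 1 / 2) {Θ : Set (Param p)}
    {T : EuclideanSpace ℝ (Fin p) → ℝ} {CI : RandomInterval n p}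
    (hCI : CI ∈ confidenceIntervals n α Θ T) {θ : Param p} (hθ : θ ∈ Θ)
    [IsProbabilityMeasure (dataLaw n θ)] {b : ℝ}
    (hb : ENNReal.ofReal (1 - α) ≤ dataLaw n θ {z | CI.l z ≤ b ∧ b ≤ CI.u z} +
      ENNReal.ofReal ((1 - 2 * α) / 2)) :
    ENNReal.ofReal (|b - T θ.β| * ((1 - 2 * α) / 2)) ≤ expectedLength CI θ := by
  have hl := CI.measurable_l
  have hu := CI.measurable_u
  set P := dataLaw n θ
  have hms : ∀ c : ℝ, MeasurableSet {z | CI.l z ≤ c ∧ c ≤ CI.u z} := fun c =>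
    (measurableSet_le hl measurable_const).inter (measurableSet_le measurable_const hu)
  set A := {z | CI.l z ≤ T θ.β ∧ T θ.β ≤ CI.u z}
  set B := {z | CI.l z ≤ b ∧ b ≤ CI.u z}
  have hA : ENNReal.ofReal (1 - α) ≤ P A := by
    have := hCI
    simp only [confidenceIntervals, Set.mem_ofPred_eq, le_iInf_iff] at this
    exact this θ hθ
  have hAr : 1 - α ≤ P.real A := (ENNReal.ofReal_le_iff_le_toReal (measure_ne_top _ _)).1 hA
  have hBr : 1 - α ≤ P.real B + (1 - 2 * α) / 2 := by
    rw [ENNReal.ofReal_le_iff_le_toReal (by finiteness), ENNReal.toReal_add (by finiteness)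
      (by finiteness), ENNReal.toReal_ofReal (by linarith)] at hb
    exact hb
  -- Inclusion-exclusion: `(1 - α) + (1 - α - (1 - 2α)/2) - 1 = (1 - 2α)/2`.
  have hI : (1 - 2 * α) / 2 ≤ P.real (A ∩ B) := by
    have := measureReal_union_add_inter (μ := P) (s := A) (hms b)
    have h1 : P.real (A ∪ B) ≤ 1 := measureReal_le_one
    have h2 : P.real (A ∪ B) + P.real (A ∩ B) = P.real A + P.real B := this
    linarith
  have hIe : ENNReal.ofReal ((1 - 2 * α) / 2) ≤ P (A ∩ B) :=
    (ENNReal.ofReal_le_iff_le_toReal (measure_ne_top _ _)).2 hI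
  calc ENNReal.ofReal (|b - T θ.β| * ((1 - 2 * α) / 2))
      = ENNReal.ofReal |b - T θ.β| * ENNReal.ofReal ((1 - 2 * α) / 2) :=
        ENNReal.ofReal_mul (abs_nonneg _)
    _ ≤ ENNReal.ofReal |b - T θ.β| * P (A ∩ B) := by gcongr
    _ = ∫⁻ _z in A ∩ B, ENNReal.ofReal |b - T θ.β| ∂P := by rw [setLIntegral_const]
    _ ≤ ∫⁻ z in A ∩ B, ENNReal.ofReal (CI.u z - CI.l z) ∂P := by
        refine setLIntegral_mono (by fun_prop) fun z hz => ENNReal.ofReal_le_ofReal ?_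
        obtain ⟨⟨h1, h2⟩, h3, h4⟩ := hz
        exact abs_le.2 ⟨by linarith, by linarith⟩
    _ ≤ expectedLength CI θ := setLIntegral_le_lintegral _ _

/-- Lower bound on the expected length at `θ` when `θ` and a finite family of parameters are
all images of correlated standard Gaussian laws under a common map, and the functional takes the
same value `b` on the family. -/
theorem ofReal_le_expectedLength_of_corrLaw {n p : ℕ} {α : ℝ} (hα : α < 1 / 2)
    {Θ : Set (Param p)} {T : EuclideanSpace ℝ (Fin p) → ℝ} {CI : RandomInterval n p}
    (hCI : CI ∈ confidenceIntervals n α Θ T) {θ : Param p} (hθ : θ ∈ Θ)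
    {F D : Type*} [NormedAddCommGroup F] [InnerProductSpace ℝ F] [FiniteDimensional ℝ F]
    [MeasurableSpace F] [BorelSpace F] [Fintype D] [Nonempty D]
    {φ : ℝ × F → Obs p} (hφ : Measurable φ) (h0 : obsLaw θ = (stdPair F).map φ)
    {r : ℝ} (hr : r ^ 2 < 1) {w : D → F} (hw : ∀ d, ‖w d‖ = 1) {θ' : D → Param p}
    (hΘ : ∀ d, θ' d ∈ Θ) (h1 : ∀ d, obsLaw (θ' d) = (corrLaw r (w d)).map φ)
    {b : ℝ} (hb : ∀ d, T (θ' d).β = b)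
    (hχ : ∑ d, ∑ d', ((1 - r ^ 2 * inner ℝ (w d) (w d'))⁻¹) ^ n ≤
      (1 + ((1 - 2 * α) / 2) ^ 2) * (Fintype.card D : ℝ) ^ 2) :
    ENNReal.ofReal (|b - T θ.β| * ((1 - 2 * α) / 2)) ≤ expectedLength CI θ := by
  have hp0 : IsProbabilityMeasure ((stdPair F).map φ) :=
    Measure.isProbabilityMeasure_map hφ.aemeasurable
  have hpd : ∀ d, IsProbabilityMeasure ((corrLaw r (w d)).map φ) := fun d =>
    Measure.isProbabilityMeasure_map hφ.aemeasurable
  have hP : IsProbabilityMeasure (dataLaw n θ) := by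
    unfold dataLaw; rw [h0]; infer_instance
  refine ofReal_le_expectedLength hα hCI hθ ?_
  -- Since every data law is an image under the same `Φ`, the coverage event can be pulled back and
  -- the chi-square computation done on the Gaussian pairs.
  set Φ : (Fin n → ℝ × F) → (Fin n → Obs p) := fun z i => φ (z i) with hΦ
  have hΦm : Measurable Φ := by fun_prop
  set Q : Measure (Fin n → ℝ × F) := Measure.pi fun _ => stdPair F
  set f : D → ℝ × F → ℝ≥0∞ := fun d z => ENNReal.ofReal (corrDensity r z.1 (inner ℝ (w d) z.2))
    with hf
  have hfm : ∀ d, Measurable (f d) := fun d => measurable_corrDensity_inner r (w d)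
  have hfd : ∀ d, corrLaw r (w d) = (stdPair F).withDensity (f d) := fun d =>
    corrLaw_eq_withDensity hr (w d)
  have hfp : ∀ d, IsProbabilityMeasure ((stdPair F).withDensity (f d)) := fun d => by
    rw [← hfd d]; infer_instance
  have hd0 : dataLaw n θ = Q.map Φ := by
    unfold dataLaw
    rw [h0]
    exact (Measure.pi_map_pi fun _ => hφ.aemeasurable).symm
  have hd1 : ∀ d, dataLaw n (θ' d) = (Q.withDensity fun z => ∏ i, f d (z i)).map Φ := by
    intro d
    unfold dataLaw
    rw [h1 d, ← pi_withDensity_eq (stdPair F) (f d) (hfm d), ← hfd d]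
    exact (Measure.pi_map_pi fun _ => hφ.aemeasurable).symm
  have hms : MeasurableSet {z | CI.l z ≤ b ∧ b ≤ CI.u z} :=
    (measurableSet_le CI.measurable_l measurable_const).inter
      (measurableSet_le measurable_const CI.measurable_u)
  rw [hd0, Measure.map_apply hΦm hms]
  refine le_measure_add_of_mixture_chiSq Q (fun d z => ∏ i, f d (z i)) (fun d => by fun_prop) ?_
    (by linarith) ?_ (hΦm hms) ?_
  · intro d
    rw [lintegral_pi_prod_eq_prod (stdPair F) (fun _ => f d) fun _ => hfm d]
    have : ∫⁻ y, f d y ∂(stdPair F) = 1 := by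
      have := (hfp d).measure_univ
      rwa [withDensity_apply _ MeasurableSet.univ, setLIntegral_univ] at this
    simp [this]
  · have hpos : ∀ d d', 0 ≤ (1 - r ^ 2 * inner ℝ (w d) (w d'))⁻¹ := by
      intro d d'
      have h3 := real_inner_le_norm (w d) (w d')
      rw [hw, hw, mul_one] at h3
      have : r ^ 2 * inner ℝ (w d) (w d') ≤ r ^ 2 * 1 := by gcongr
      exact inv_nonneg.2 (by linarith)
    have e : ∀ d d', ∫⁻ z, (∏ i, f d (z i)) * (∏ i, f d' (z i)) ∂Q =
        ENNReal.ofReal (((1 - r ^ 2 * inner ℝ (w d) (w d'))⁻¹) ^ n) := by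
      intro d d'
      simp_rw [← Finset.prod_mul_distrib]
      rw [lintegral_pi_prod_eq_prod (stdPair F) (fun _ y => f d y * f d' y)
        fun _ => (hfm d).mul (hfm d')]
      simp only [hf, lintegral_corrDensity_inner_mul hr (hw d) (hw d'), Finset.prod_const,
        Finset.card_univ, Fintype.card_fin]
      rw [ENNReal.ofReal_pow (hpos d d')]
    simp_rw [e]
    calc _ = ENNReal.ofReal (∑ d, ∑ d', ((1 - r ^ 2 * inner ℝ (w d) (w d'))⁻¹) ^ n) := by
          rw [ENNReal.ofReal_sum_of_nonneg fun d _ => Finset.sum_nonneg fun d' _ =>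
            pow_nonneg (hpos d d') n]
          exact Finset.sum_congr rfl fun d _ =>
            (ENNReal.ofReal_sum_of_nonneg fun d' _ => pow_nonneg (hpos d d') n).symm
      _ ≤ _ := by
          refine (ENNReal.ofReal_le_ofReal hχ).trans ?_
          rw [ENNReal.ofReal_mul (by positivity), ENNReal.ofReal_pow (by positivity),
            ENNReal.ofReal_natCast]
  · intro d
    rw [← Measure.map_apply hΦm hms, ← hd1 d]
    have h4 := hCI
    simp only [confidenceIntervals, Set.mem_ofPred_eq, le_iInf_iff] at h4
    have h5 := h4 (θ' d) (hΘ d)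
    rwa [hb d] at h5

/-! ### The observation laws as images of correlated Gaussian pairs -/

section ObsLaw

variable {p : ℕ}

theorem charFunPair_obsLaw (θ : Param p) (h : θ.Ω⁻¹.PosSemidef) (s : ℝ)
    (t : EuclideanSpace ℝ (Fin p)) :
    charFunPair (obsLaw θ) s t =
      Complex.exp ((-((s • θ.β + t).ofLp ⬝ᵥ θ.Ω⁻¹.mulVec (s • θ.β + t).ofLp +
        s ^ 2 * θ.σ ^ 2) / 2 : ℝ) : ℂ) := by
  have h1 := charFun_multivariateGaussian (μ := 0) h (s • θ.β + t)
  have h2 := charFun_gaussianReal (μ := 0) (v := (θ.σ ^ 2).toNNReal) s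
  rw [charFunPair, obsLaw, integral_map (by fun_prop) (by fun_prop)]
  have h3 : ∀ w : EuclideanSpace ℝ (Fin p) × ℝ,
      Complex.exp (((s * (inner ℝ w.1 θ.β + w.2) + inner ℝ w.1 t : ℝ) : ℂ) * Complex.I) =
      Complex.exp ((inner ℝ w.1 (s • θ.β + t) : ℝ) * Complex.I) *
        Complex.exp ((inner ℝ w.2 s : ℝ) * Complex.I) := by
    intro w
    rw [← Complex.exp_add]
    congr 1
    rw [inner_add_right, real_inner_smul_right, RCLike.inner_apply, conj_trivial]
    push_cast
    ring
  simp_rw [h3]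
  rw [integral_prod_mul (fun x : EuclideanSpace ℝ (Fin p) =>
      Complex.exp ((inner ℝ x (s • θ.β + t) : ℝ) * Complex.I))
    (fun x : ℝ => Complex.exp ((inner ℝ x s : ℝ) * Complex.I)),
    ← charFun_apply, ← charFun_apply, h1, h2, ← Complex.exp_add]
  congr 1
  rw [inner_zero_right]
  have h4 : (((θ.σ ^ 2).toNNReal : ℝ) : ℂ) = (θ.σ : ℂ) ^ 2 := by
    rw [Real.coe_toNNReal _ (sq_nonneg _)]; push_cast; rfl
  rw [h4]
  push_cast
  ring

instance (θ : Param p) : IsProbabilityMeasure (obsLaw θ) :=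
  Measure.isProbabilityMeasure_map (by fun_prop)

theorem quadForm_one (z : EuclideanSpace ℝ (Fin p)) :
    z.ofLp ⬝ᵥ (1 : Matrix (Fin p) (Fin p) ℝ).mulVec z.ofLp = ‖z‖ ^ 2 := by
  rw [Matrix.one_mulVec, EuclideanSpace.real_norm_sq_eq, dotProduct]
  exact Finset.sum_congr rfl fun i _ => by ring

/-- Perturbing the regression vector along `w`, with the variance of the response kept fixed. -/
theorem obsLaw_shift {r : ℝ} (hr : r ^ 2 ≤ 1) (β w : EuclideanSpace ℝ (Fin p)) (σ : ℝ) :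
    obsLaw ⟨β + (σ * r) • w, 1, σ * √(1 - r ^ 2)⟩ =
      (corrLaw r w).map fun z => (inner ℝ z.2 β + σ * z.1, z.2) := by
  have : IsProbabilityMeasure ((corrLaw r w).map
      fun z : ℝ × EuclideanSpace ℝ (Fin p) => ((inner ℝ z.2 β + σ * z.1, z.2) : Obs p)) :=
    Measure.isProbabilityMeasure_map (by fun_prop)
  refine ext_of_charFunPair fun s t => ?_
  rw [charFunPair_obsLaw _ (by simpa using Matrix.PosSemidef.one), inv_one, quadForm_one]
  trans charFunPair (corrLaw r w) (s * σ) (s • β + t)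
  · rw [charFunPair_corrLaw hr, mul_pow σ, Real.sq_sqrt (by linarith)]
    congr 3
    have : s • (β + (σ * r) • w) + t = s • β + t + (s * σ * r) • w := by module
    rw [this]
    ring
  · rw [charFunPair, charFunPair, integral_map (by fun_prop) (by fun_prop)]
    congr 1 with z
    congr 3
    rw [inner_add_right, real_inner_smul_right]
    ring

/-- The covariance matrix with unit variances in all directions orthogonal to `e` and `d`, and
covariance `κ` between the directions `e` and `d`. -/
noncomputable def crossCov (κ : ℝ) (e d : EuclideanSpace ℝ (Fin p)) : Matrix (Fin p) (Fin p) ℝ :=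
  1 + κ • (Matrix.vecMulVec e.ofLp d.ofLp + Matrix.vecMulVec d.ofLp e.ofLp)

theorem isHermitian_crossCov (κ : ℝ) (e d : EuclideanSpace ℝ (Fin p)) :
    (crossCov κ e d).IsHermitian := by
  ext i j
  simp only [crossCov, Matrix.conjTranspose_apply, Matrix.add_apply, Matrix.smul_apply,
    Matrix.vecMulVec_apply, Matrix.one_apply, star_trivial, smul_eq_mul, eq_comm (a := i)]
  ring

theorem quadForm_crossCov (κ : ℝ) (e d z : EuclideanSpace ℝ (Fin p)) :
    z.ofLp ⬝ᵥ (crossCov κ e d).mulVec z.ofLp =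
      ‖z‖ ^ 2 + 2 * κ * inner ℝ e z * inner ℝ d z := by
  have h1 : ∀ x : EuclideanSpace ℝ (Fin p), z.ofLp ⬝ᵥ x.ofLp = inner ℝ x z := by
    intro x
    rw [PiLp.inner_apply, dotProduct]
    exact Finset.sum_congr rfl fun i _ => by simp
  have h2 : ∀ x : EuclideanSpace ℝ (Fin p), x.ofLp ⬝ᵥ z.ofLp = inner ℝ x z := by
    intro x
    rw [dotProduct_comm, h1]
  rw [crossCov, Matrix.add_mulVec, dotProduct_add, quadForm_one, Matrix.smul_mulVec,
    Matrix.add_mulVec, dotProduct_smul, dotProduct_add, Matrix.vecMulVec_mulVec,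
    Matrix.vecMulVec_mulVec]
  simp only [op_smul_eq_smul]
  rw [dotProduct_smul, dotProduct_smul, h2, h2, h1, h1]
  simp only [smul_eq_mul]
  ring

theorem inner_sq_add_inner_sq_le {F : Type*} [NormedAddCommGroup F] [InnerProductSpace ℝ F]
    {e d : F} (he : ‖e‖ = 1) (hd : ‖d‖ = 1) (hed : inner ℝ e d = (0 : ℝ)) (z : F) :
    (inner ℝ e z : ℝ) ^ 2 + (inner ℝ d z : ℝ) ^ 2 ≤ ‖z‖ ^ 2 := by
  have h := sq_nonneg ‖z - ((inner ℝ e z : ℝ) • e + (inner ℝ d z : ℝ) • d)‖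
  rw [norm_sub_sq_real, norm_add_sq_real, inner_add_right, real_inner_smul_right,
    real_inner_smul_right, real_inner_smul_left, real_inner_smul_right, hed, norm_smul, norm_smul,
    he, hd, real_inner_comm e z, real_inner_comm d z] at h
  simp only [mul_one, Real.norm_eq_abs, sq_abs, mul_zero] at h
  linarith

theorem abs_quadForm_crossCov_sub_le {κ : ℝ} (hκ : 0 ≤ κ) {e d : EuclideanSpace ℝ (Fin p)}
    (he : ‖e‖ = 1) (hd : ‖d‖ = 1) (hed : inner ℝ e d = (0 : ℝ)) (z : EuclideanSpace ℝ (Fin p)) :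
    |z.ofLp ⬝ᵥ (crossCov κ e d).mulVec z.ofLp - ‖z‖ ^ 2| ≤ κ * ‖z‖ ^ 2 := by
  rw [quadForm_crossCov]
  have h := mul_le_mul_of_nonneg_left (inner_sq_add_inner_sq_le he hd hed z) hκ
  have h1 := mul_nonneg hκ (sq_nonneg ((inner ℝ e z : ℝ) - inner ℝ d z))
  have h2 := mul_nonneg hκ (sq_nonneg ((inner ℝ e z : ℝ) + inner ℝ d z))
  rw [abs_le]
  constructor <;> nlinarith

theorem posDef_crossCov {κ : ℝ} (hκ : 0 ≤ κ) (hκ1 : κ < 1) {e d : EuclideanSpace ℝ (Fin p)}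
    (he : ‖e‖ = 1) (hd : ‖d‖ = 1) (hed : inner ℝ e d = (0 : ℝ)) : (crossCov κ e d).PosDef := by
  refine Matrix.PosDef.of_dotProduct_mulVec_pos (isHermitian_crossCov κ e d) fun x hx => ?_
  have h := abs_le.1 (abs_quadForm_crossCov_sub_le hκ he hd hed (WithLp.toLp 2 x))
  have hx' : 0 < ‖WithLp.toLp 2 x‖ := by simpa using hx
  have : 0 < (1 - κ) * ‖WithLp.toLp 2 x‖ ^ 2 := by
    have : 0 < 1 - κ := by linarith
    positivity
  simp only [star_trivial] at *
  linarith [h.1]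

/-- The quadratic form of `crossCov` on unit vectors lies in `[1 - κ, 1 + κ]`, and an eigenvalue of
the inverse is the reciprocal of that form at its unit eigenvector. -/
theorem eigenvalues_inv_crossCov {κ M : ℝ} (hκ : 0 ≤ κ) (hM : 1 < M) (hκM : κ ≤ 1 - 1 / M)
    {e d : EuclideanSpace ℝ (Fin p)} (he : ‖e‖ = 1) (hd : ‖d‖ = 1)
    (hed : inner ℝ e d = (0 : ℝ)) :
    ∃ h : (crossCov κ e d)⁻¹.IsHermitian, ∀ i, 1 / M ≤ h.eigenvalues i ∧ h.eigenvalues i ≤ M := by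
  have hM0 : 0 < M := by linarith
  have hMinv : 0 < 1 / M := by positivity
  have hMM : M * (1 / M) = 1 := by field_simp
  have hpd := posDef_crossCov hκ (by linarith) he hd hed
  refine ⟨(isHermitian_crossCov κ e d).inv, fun i => ?_⟩
  set h := (isHermitian_crossCov κ e d).inv
  set v := h.eigenvectorBasis i
  set l := h.eigenvalues i
  have hv : ‖v‖ = 1 := h.eigenvectorBasis.orthonormal.1 i
  have h1 : (crossCov κ e d)⁻¹.mulVec v.ofLp = l • v.ofLp := h.mulVec_eigenvectorBasis i
  have h2 : v.ofLp = l • (crossCov κ e d).mulVec v.ofLp := by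
    rw [← Matrix.mulVec_smul, ← h1, Matrix.mulVec_mulVec,
      Matrix.mul_nonsing_inv _ ((Matrix.isUnit_iff_isUnit_det _).1 hpd.isUnit), Matrix.one_mulVec]
  have h3 : 1 = l * (v.ofLp ⬝ᵥ (crossCov κ e d).mulVec v.ofLp) := by
    have h4 := quadForm_one v
    rw [Matrix.one_mulVec, hv] at h4
    rw [← smul_eq_mul, ← dotProduct_smul, ← h2, h4]
    norm_num
  have h5 := abs_le.1 (abs_quadForm_crossCov_sub_le hκ he hd hed v)
  rw [hv] at h5
  set q := v.ofLp ⬝ᵥ (crossCov κ e d).mulVec v.ofLp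
  have hq1 : 1 / M ≤ q := by linarith [h5.1]
  -- Here `1 + κ ≤ 2 - 1/M ≤ M`, because `M + 1/M ≥ 2`.
  have hq2 : q ≤ M := by nlinarith [h5.2]
  have hq0 : 0 < q := by linarith
  have hl : l = 1 / q := by field_simp; linarith
  rw [hl]
  constructor
  · exact one_div_le_one_div_of_le hq0 hq2
  · rw [div_le_iff₀ hq0]; nlinarith

/-- The observation obtained from `(u, x)` by rotating the pair formed by `u` and the coordinate
of `x` along `e`, the first rotated variable being the normalized noise and the second the new
coordinate of the design along `e`. -/
noncomputable def rotatedObs (β e : EuclideanSpace ℝ (Fin p)) (σ : ℝ)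
    (z : ℝ × EuclideanSpace ℝ (Fin p)) : Obs p :=
  (inner ℝ (z.2 + ((z.1 - inner ℝ e z.2) / √2 - inner ℝ e z.2) • e) β +
      σ * ((z.1 + inner ℝ e z.2) / √2),
    z.2 + ((z.1 - inner ℝ e z.2) / √2 - inner ℝ e z.2) • e)

theorem measurable_rotatedObs (β e : EuclideanSpace ℝ (Fin p)) (σ : ℝ) :
    Measurable (rotatedObs β e σ) := by
  unfold rotatedObs; fun_prop

/-- A parameter under which both the noise-plus-signal and the coordinate along `e` have covariance
`κ` with the coordinate along `d`, all other second moments of the normalized data being as under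
`(β, I, σ)`. -/
noncomputable def hiddenParam (β e d : EuclideanSpace ℝ (Fin p)) (σ κ : ℝ) : Param p where
  β := β + σ • ((-(κ ^ 2 / (1 - κ ^ 2))) • e + (κ / (1 - κ ^ 2)) • d)
  Ω := (crossCov κ e d)⁻¹
  σ := σ * √((1 - 2 * κ ^ 2) / (1 - κ ^ 2))

/-- Correlation `√2 κ` between `u` and `x_d` is split evenly by the rotation: noise and `x_e` each
get covariance `κ` with `x_d` and stay uncorrelated. Regressing the noise on `(x_e, x_d)` gives the
coefficients `(-κ², κ)/(1 - κ²)` and residual variance `1 - κ²/(1 - κ²)`, which are those of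
`hiddenParam`. -/
theorem obsLaw_hiddenParam {κ : ℝ} (hκ : 0 ≤ κ) (hκ1 : 2 * κ ^ 2 < 1)
    {e d : EuclideanSpace ℝ (Fin p)} (he : ‖e‖ = 1) (hd : ‖d‖ = 1) (hed : inner ℝ e d = (0 : ℝ))
    (β : EuclideanSpace ℝ (Fin p)) (σ : ℝ) :
    obsLaw (hiddenParam β e d σ κ) = (corrLaw (√2 * κ) d).map (rotatedObs β e σ) := by
  have : IsProbabilityMeasure ((corrLaw (√2 * κ) d).map (rotatedObs β e σ)) :=
    Measure.isProbabilityMeasure_map (measurable_rotatedObs β e σ).aemeasurable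
  have h2 : √2 ^ 2 = (2 : ℝ) := Real.sq_sqrt (by norm_num)
  have h2p : 0 < √(2 : ℝ) := by positivity
  have hr : (√2 * κ) ^ 2 ≤ 1 := by rw [mul_pow, h2]; linarith
  have hk1 : 0 < 1 - κ ^ 2 := by nlinarith [sq_nonneg κ]
  have hpd := posDef_crossCov hκ (by nlinarith) he hd hed
  have hinv : (crossCov κ e d)⁻¹⁻¹ = crossCov κ e d :=
    Matrix.nonsing_inv_nonsing_inv _ ((Matrix.isUnit_iff_isUnit_det _).1 hpd.isUnit)
  refine ext_of_charFunPair fun s t => ?_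
  set ze : ℝ := inner ℝ e (s • β + t) with hze
  set zd : ℝ := inner ℝ d (s • β + t) with hzd
  -- The frequencies are the image of `(s, t)` under the adjoint of the linear map `rotatedObs`.
  trans charFunPair (corrLaw (√2 * κ) d) ((ze + s * σ) / √2)
    (s • β + t + ((s * σ - ze) / √2 - ze) • e)
  · rw [charFunPair_obsLaw _ (by rw [hiddenParam, hinv]; exact hpd.posSemidef),
      charFunPair_corrLaw hr]
    congr 3
    simp only [hiddenParam]
    rw [hinv, quadForm_crossCov]
    have e1 : s • (β + σ • ((-(κ ^ 2 / (1 - κ ^ 2))) • e + (κ / (1 - κ ^ 2)) • d)) + t =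
        (s • β + t) + ((s * σ * (-(κ ^ 2 / (1 - κ ^ 2)))) • e +
          (s * σ * (κ / (1 - κ ^ 2))) • d) := by module
    rw [e1]
    generalize s • β + t = z at hze hzd
    have hde : inner ℝ d e = (0 : ℝ) := by rw [real_inner_comm]; exact hed
    have hee : inner ℝ e e = (1 : ℝ) := by rw [real_inner_self_eq_norm_sq, he]; norm_num
    have hdd : inner ℝ d d = (1 : ℝ) := by rw [real_inner_self_eq_norm_sq, hd]; norm_num
    simp only [← real_inner_self_eq_norm_sq, inner_add_left, inner_add_right,
      real_inner_smul_left, real_inner_smul_right, hde, hed, hee, hdd, real_inner_comm z e,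
      real_inner_comm z d]
    rw [real_inner_comm e z, real_inner_comm d z, ← hze, ← hzd, mul_pow σ,
      Real.sq_sqrt (div_nonneg (by linarith) hk1.le)]
    have hdiv : ∀ x : ℝ, x / √2 = x * √2 / 2 := fun x => by
      rw [div_eq_div_iff h2p.ne' two_ne_zero, mul_assoc, Real.mul_self_sqrt zero_le_two]
    simp only [hdiv]
    trans -(inner ℝ z z + 2 * κ * (ze + s * σ) * zd + (s * σ) ^ 2)
    · field_simp
      ring
    · linear_combination (((ze + s * σ) ^ 2 + (s * σ - ze) ^ 2) / 4 + κ * (ze + s * σ) * zd) * h2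
  · rw [charFunPair, charFunPair, integral_map (measurable_rotatedObs β e σ).aemeasurable
      (by fun_prop)]
    congr 1 with z
    congr 3
    simp only [rotatedObs]
    have hX : ∀ x, s * inner ℝ x β + inner ℝ x t = (inner ℝ x (s • β + t) : ℝ) := fun x => by
      rw [inner_add_right, real_inner_smul_right]
    rw [inner_add_right z.2, real_inner_smul_right z.2]
    trans inner ℝ (z.2 + ((z.1 - inner ℝ e z.2) / √2 - inner ℝ e z.2) • e) (s • β + t) +
      s * (σ * ((z.1 + inner ℝ e z.2) / √2))
    · rw [inner_add_left, real_inner_smul_left, ← hze, real_inner_comm e z.2]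
      field_simp
      ring
    · rw [← hX]
      ring

end ObsLaw

/-! ### Sparse directions and their overlaps -/

theorem inv_one_sub_le_exp {x : ℝ} (h0 : 0 ≤ x) (h1 : x ≤ 1 / 2) :
    (1 - x)⁻¹ ≤ Real.exp (2 * x) := by
  have h2 := Real.add_one_le_exp (2 * x)
  rw [inv_le_iff_one_le_mul₀ (by linarith)]
  nlinarith

theorem inv_one_sub_pow_le_exp {x : ℝ} (h0 : 0 ≤ x) (h1 : x ≤ 1 / 2) (n : ℕ) :
    ((1 - x)⁻¹) ^ n ≤ Real.exp (2 * n * x) := by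
  have : Real.exp (2 * n * x) = Real.exp (2 * x) ^ n := by
    rw [← Real.exp_nat_mul]; congr 1; ring
  rw [this]
  exact pow_le_pow_left₀ (inv_nonneg.2 (by linarith)) (inv_one_sub_le_exp h0 h1) n

/-- The normalized indicator vector of the range of `J`. -/
noncomputable def sparseDir {p m : ℕ} (J : Fin m → Fin p) : EuclideanSpace ℝ (Fin p) :=
  (√(m : ℝ))⁻¹ • ∑ i, EuclideanSpace.single (J i) (1 : ℝ)

theorem inner_sparseDir {p m : ℕ} (J J' : Fin m → Fin p) :
    (inner ℝ (sparseDir J) (sparseDir J') : ℝ) =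
      (m : ℝ)⁻¹ * ∑ i, ∑ j, if J i = J' j then 1 else 0 := by
  rw [sparseDir, sparseDir, real_inner_smul_left, real_inner_smul_right, ← mul_assoc, ← mul_inv,
    Real.mul_self_sqrt (Nat.cast_nonneg m), sum_inner]
  congr 1
  refine Finset.sum_congr rfl fun i _ => ?_
  rw [inner_sum]
  refine Finset.sum_congr rfl fun j _ => ?_
  simp [EuclideanSpace.inner_single_left]

theorem norm_sparseDir {p m : ℕ} (hm : 1 ≤ m) {J : Fin m → Fin p} (hJ : Function.Injective J) :
    ‖sparseDir J‖ = 1 := by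
  have hm' : (m : ℝ) ≠ 0 := by positivity
  refine (pow_eq_one_iff_of_nonneg (norm_nonneg _) two_ne_zero).1 ?_
  rw [← real_inner_self_eq_norm_sq, inner_sparseDir]
  simp [hJ.eq_iff, hm']

theorem sparseDir_apply_eq_zero {p m : ℕ} {J : Fin m → Fin p} {a : Fin p} (ha : ∀ i, J i ≠ a) :
    (sparseDir J).ofLp a = 0 := by
  simp only [sparseDir, PiLp.smul_apply, smul_eq_mul, WithLp.ofLp_sum, Finset.sum_apply]
  rw [Finset.sum_eq_zero, mul_zero]
  intro i _
  simp [(ha i).symm]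

theorem hammingNorm_add_le_of_support {p : ℕ} (x y : Fin p → ℝ) (S : Finset (Fin p))
    (hS : ∀ a, a ∉ S → y a = 0) : hammingNorm (x + y) ≤ hammingNorm x + S.card := by
  classical
  unfold hammingNorm
  refine le_trans (Finset.card_le_card ?_) (Finset.card_union_le _ _)
  intro a ha
  simp only [Finset.mem_filter, Finset.mem_univ, true_and, Finset.mem_union, Pi.add_apply] at ha ⊢
  by_contra h
  push Not at h
  rw [h.1, hS a h.2, add_zero] at ha
  exact ha rfl

/-- For fixed `f` the sum over `g` factors over the `m` blocks. In each block one choice agrees and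
contributes `s`, while the other `Q - 1` contribute `1`. -/
theorem sum_sum_prod_agreement {m Q : ℕ} (s : ℝ) :
    ∑ f : Fin m → Fin Q, ∑ g : Fin m → Fin Q, ∏ i, (if f i = g i then s else 1) =
      (Q : ℝ) ^ m * (Q - 1 + s) ^ m := by
  have h1 : ∀ f : Fin m → Fin Q, ∑ g : Fin m → Fin Q, ∏ i, (if f i = g i then s else 1) =
      (Q - 1 + s) ^ m := by
    intro f
    rw [← Fintype.piFinset_univ, ← Finset.prod_univ_sum (fun _ => Finset.univ)
      (fun i c => if f i = c then s else 1)]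
    have : ∀ i, ∑ c, (if f i = c then s else (1 : ℝ)) = Q - 1 + s := by
      intro i
      have e : ∀ c, (if f i = c then s else (1 : ℝ)) = 1 + if f i = c then s - 1 else 0 := by
        intro c; split_ifs <;> ring
      simp_rw [e]
      rw [Finset.sum_add_distrib]
      simp
      ring
    simp_rw [this]
    simp
  simp_rw [h1]
  simp

theorem paramSpace_mono {p : ℕ} {M₁ M₂ : ℝ} {k₁ k : ℕ} {θ : Param p}
    (hθ : θ ∈ paramSpace p M₁ M₂ k₁) (hk : k₁ ≤ k) : θ ∈ paramSpace p M₁ M₂ k :=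
  ⟨hθ.1.trans hk, hθ.2⟩

/-! ### The two lower bounds -/

theorem ofReal_le_expectedLength_parametric {n p k k₁ : ℕ} (hn : 1 ≤ n) {α M₁ M₂ t : ℝ}
    (hα : α < 1 / 2) (ht0 : 0 ≤ t) (ht : t ^ 2 ≤ 1 / 2)
    (hη : Real.exp (2 * t ^ 2) ≤ 1 + ((1 - 2 * α) / 2) ^ 2) (hk : k₁ + 1 ≤ k) (a : Fin p)
    {CI : RandomInterval n p}
    (hCI : CI ∈ confidenceIntervals n α (paramSpace p M₁ M₂ k) fun β => β a)
    {θ : Param p} (hθ : θ ∈ paramSpace p M₁ M₂ k₁) (hΩ : θ.Ω = 1) :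
    ENNReal.ofReal (θ.σ * (t / √n) * ((1 - 2 * α) / 2)) ≤ expectedLength CI θ := by
  have hn0 : (0 : ℝ) < n := by exact_mod_cast hn
  have hn1 : (1 : ℝ) ≤ n := by exact_mod_cast hn
  obtain ⟨β, Ω, σ⟩ := θ
  obtain rfl : Ω = 1 := hΩ
  have hσ : 0 < σ := hθ.2.2.1
  have hσM : σ ≤ M₂ := hθ.2.2.2
  set r : ℝ := t / √n with hr
  have hr0 : 0 ≤ r := by positivity
  have hr2 : r ^ 2 = t ^ 2 / n := by rw [hr, div_pow, Real.sq_sqrt hn0.le]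
  have hnr : n * r ^ 2 = t ^ 2 := by rw [hr2]; field_simp
  have hr1 : r ^ 2 ≤ 1 / 2 := by
    rw [hr2]; exact (div_le_self (sq_nonneg t) hn1).trans ht
  have hs : 0 < √(1 - r ^ 2) := Real.sqrt_pos.2 (by linarith)
  have hs1 : √(1 - r ^ 2) ≤ 1 := Real.sqrt_le_one.2 (by linarith [sq_nonneg r])
  set w : EuclideanSpace ℝ (Fin p) := EuclideanSpace.single a 1 with hw
  have hwn : ‖w‖ = 1 := by simp [hw]
  -- The null law is the member `r = 0` of the shifted family.
  have h0 : obsLaw ⟨β, 1, σ⟩ = (stdPair _).map fun z => (inner ℝ z.2 β + σ * z.1, z.2) := by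
    have := obsLaw_shift (r := 0) (by norm_num) β w σ
    rwa [mul_zero, zero_smul, add_zero, corrLaw_zero, zero_pow two_ne_zero, sub_zero,
      Real.sqrt_one, mul_one] at this
  have hmem : (⟨β + (σ * r) • w, 1, σ * √(1 - r ^ 2)⟩ : Param p) ∈ paramSpace p M₁ M₂ k := by
    refine ⟨?_, hθ.2.1, by positivity, (mul_le_of_le_one_right hσ.le hs1).trans hσM⟩
    refine le_trans ?_ (le_trans (Nat.add_le_add_right hθ.1 1) hk)
    refine (hammingNorm_add_le_of_support β.ofLp ((σ * r) • w).ofLp {a} ?_).trans (by simp)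
    intro b hb
    have : b ≠ a := by simpa using hb
    simp [hw, this]
  have key := ofReal_le_expectedLength_of_corrLaw (D := Unit) hα hCI
    (paramSpace_mono hθ (by omega)) (by fun_prop) h0 (by linarith : r ^ 2 < 1)
    (w := fun _ => w) (fun _ => hwn) (fun _ => hmem)
    (fun _ => obsLaw_shift (by linarith) β w σ) (b := β.ofLp a + σ * r)
    (fun _ => by simp [hw]) (by
      simp only [Finset.univ_unique, Finset.sum_const, Finset.card_singleton, one_smul,
        Fintype.card_unit, Nat.cast_one, one_pow, mul_one, real_inner_self_eq_norm_sq, hwn]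
      refine (inv_one_sub_pow_le_exp (sq_nonneg r) hr1 n).trans ?_
      rwa [mul_assoc, hnr])
  simpa [abs_of_nonneg hr0, abs_of_pos hσ] using key

theorem ofReal_le_expectedLength_sparse {n p k k₁ m Q : ℕ} (hn : 1 ≤ n) {α M₁ M₂ τ : ℝ}
    (hα : α < 1 / 2) (hM₁ : 1 < M₁) (hτ : 0 < τ) (hp : 2 ≤ p) (hm : 1 ≤ m) (hQ : 1 ≤ Q)
    (hmQ : m * Q ≤ p - 1) (hk : k₁ + (m + 1) ≤ k)
    (hκ1 : τ * (m * (Real.log p / n)) ≤ 1 / 8)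
    (hκ2 : τ * (m * (Real.log p / n)) ≤ (1 - 1 / M₁) ^ 2)
    (hη : Real.exp (m * (p : ℝ) ^ (4 * τ) / Q) ≤ 1 + ((1 - 2 * α) / 2) ^ 2)
    {CI : RandomInterval n p}
    (hCI : CI ∈ confidenceIntervals n α (paramSpace p M₁ M₂ k) fun β => β ⟨0, by omega⟩)
    {θ : Param p} (hθ : θ ∈ paramSpace p M₁ M₂ k₁) (hΩ : θ.Ω = 1) :
    ENNReal.ofReal (θ.σ * (τ * (m * (Real.log p / n))) * ((1 - 2 * α) / 2)) ≤
      expectedLength CI θ := by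
  have hn0 : (0 : ℝ) < n := by exact_mod_cast hn
  have hp0 : (0 : ℝ) < p := by positivity
  have hp1 : (1 : ℝ) ≤ p := by exact_mod_cast (by omega : 1 ≤ p)
  have hm0 : (0 : ℝ) < m := by exact_mod_cast hm
  have hQ0 : (0 : ℝ) < Q := by exact_mod_cast hQ
  have hQ1 : (1 : ℝ) ≤ Q := by exact_mod_cast hQ
  have hlog : 0 ≤ Real.log p := Real.log_nonneg hp1
  have hM1 : 0 ≤ 1 - 1 / M₁ := by
    rw [sub_nonneg, div_le_one (by linarith)]; exact hM₁.le
  obtain ⟨β, Ω, σ⟩ := θ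
  obtain rfl : Ω = 1 := hΩ
  have hσ : 0 < σ := hθ.2.2.1
  have hσM : σ ≤ M₂ := hθ.2.2.2
  set x : ℝ := τ * (m * (Real.log p / n)) with hx
  have hx0 : 0 ≤ x := by positivity
  set κ : ℝ := √x with hκ
  have hκ0 : 0 ≤ κ := Real.sqrt_nonneg x
  have hκx : κ ^ 2 = x := Real.sq_sqrt hx0
  have hκM : κ ≤ 1 - 1 / M₁ := Real.sqrt_le_iff.2 ⟨hM1, hκ2⟩
  set a : Fin p := ⟨0, by omega⟩ with ha
  set e : EuclideanSpace ℝ (Fin p) := EuclideanSpace.single a 1 with he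
  have hen : ‖e‖ = 1 := by simp [he]
  have hlt : ∀ c : Fin m × Fin Q, (finProdFinEquiv c).val + 1 < p := fun c => by
    have := (finProdFinEquiv c).isLt
    omega
  -- The coordinates are cut into `m` disjoint blocks of size `Q`, and `f` picks one in each. The `+
  -- 1` keeps the supports away from coordinate `0`, the target of inference. Overlaps then count
  -- the blocks where two choices agree.
  set J : (Fin m → Fin Q) → Fin m → Fin p := fun f i => ⟨(finProdFinEquiv (i, f i)).val + 1, hlt _⟩
    with hJ
  have hJeq : ∀ f g i j, J f i = J g j ↔ i = j ∧ f i = g j := by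
    intro f g i j
    simp only [hJ, Fin.mk.injEq, Nat.add_right_cancel_iff, Fin.val_inj,
      EmbeddingLike.apply_eq_iff_eq, Prod.mk.injEq]
  have hJa : ∀ f i, J f i ≠ a := by
    intro f i h
    have := congrArg Fin.val h
    simp [hJ, ha] at this
  have hJinj : ∀ f, Function.Injective (J f) := fun f i j h => ((hJeq f f i j).1 h).1
  set d : (Fin m → Fin Q) → EuclideanSpace ℝ (Fin p) := fun f => sparseDir (J f) with hd
  have hdn : ∀ f, ‖d f‖ = 1 := fun f => norm_sparseDir hm (hJinj f)
  have hda : ∀ f, (d f).ofLp a = 0 := fun f => sparseDir_apply_eq_zero (hJa f)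
  have hed : ∀ f, inner ℝ e (d f) = (0 : ℝ) := fun f => by
    rw [he, EuclideanSpace.inner_single_left, hda]; simp
  have hdd : ∀ f g, (inner ℝ (d f) (d g) : ℝ) = (m : ℝ)⁻¹ * ∑ i, if f i = g i then 1 else 0 := by
    intro f g
    rw [hd, inner_sparseDir]
    congr 1
    refine Finset.sum_congr rfl fun i _ => ?_
    simp only [hJeq]
    rw [Finset.sum_eq_single i (fun j _ hj => by simp [hj.symm]) (by simp)]
    simp
  have : Nonempty (Fin Q) := ⟨⟨0, hQ⟩⟩
  have hk1 : 0 < 1 - κ ^ 2 := by linarith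
  have hr : (√2 * κ) ^ 2 = 2 * x := by rw [mul_pow, Real.sq_sqrt zero_le_two, hκx]
  have h0 : obsLaw ⟨β, 1, σ⟩ = (stdPair _).map (rotatedObs β e σ) := by
    obtain ⟨f⟩ : Nonempty (Fin m → Fin Q) := inferInstance
    have := obsLaw_hiddenParam (κ := 0) le_rfl (by norm_num) hen (hdn f) (hed f) β σ
    rw [mul_zero, corrLaw_zero] at this
    rw [← this]
    congr 1
    simp [hiddenParam, crossCov]
  have hmem : ∀ f, hiddenParam β e (d f) σ κ ∈ paramSpace p M₁ M₂ k := by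
    intro f
    have hq : 0 < (1 - 2 * κ ^ 2) / (1 - κ ^ 2) := div_pos (by linarith) hk1
    have hq1 : (1 - 2 * κ ^ 2) / (1 - κ ^ 2) ≤ 1 := by
      rw [div_le_one hk1]; linarith
    refine ⟨?_, eigenvalues_inv_crossCov hκ0 hM₁ hκM hen (hdn f) (hed f),
      mul_pos hσ (Real.sqrt_pos.2 hq),
      (mul_le_of_le_one_right hσ.le (Real.sqrt_le_one.2 hq1)).trans hσM⟩
    refine le_trans ?_ (le_trans (Nat.add_le_add_right hθ.1 (m + 1)) hk)
    refine (hammingNorm_add_le_of_support β.ofLp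
      (σ • ((-(κ ^ 2 / (1 - κ ^ 2))) • e + (κ / (1 - κ ^ 2)) • d f)).ofLp
      (insert a (Finset.univ.image (J f))) ?_).trans ?_
    · intro b hb
      simp only [Finset.mem_insert, Finset.mem_image, Finset.mem_univ, true_and, not_or,
        not_exists] at hb
      have h1 : (d f).ofLp b = 0 := sparseDir_apply_eq_zero hb.2
      simp [h1, he, hb.1]
    · refine Nat.add_le_add_left ((Finset.card_insert_le _ _).trans ?_) _
      refine Nat.add_le_add_right (Finset.card_image_le.trans ?_) 1
      simp
  -- With `κ² = x`, this is the size of the common displacement of the target coefficient; it is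
  -- downward for every `f`.
  set Δ : ℝ := σ * (x / (1 - x)) with hΔ
  have hΔ0 : 0 ≤ Δ := mul_nonneg hσ.le (div_nonneg hx0 (by linarith))
  have hxΔ : σ * x ≤ Δ := by
    refine mul_le_mul_of_nonneg_left ?_ hσ.le
    rw [le_div_iff₀ (by linarith)]
    nlinarith
  have key := ofReal_le_expectedLength_of_corrLaw hα hCI
    (paramSpace_mono hθ (by omega)) (measurable_rotatedObs β e σ) h0
    (by linarith : (√2 * κ) ^ 2 < 1) hdn hmem
    (fun f => obsLaw_hiddenParam hκ0 (by linarith) hen (hdn f) (hed f) β σ)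
    (b := β.ofLp a - Δ)
    (fun f => by
      simp only [hiddenParam, PiLp.add_apply, PiLp.smul_apply, hda, smul_eq_mul, he,
        PiLp.single_apply, if_true, hκx, hΔ]
      simp
      ring) ?_
  · refine le_trans (ENNReal.ofReal_le_ofReal ?_) key
    have : |β.ofLp a - Δ - β.ofLp a| = Δ := by
      rw [show β.ofLp a - Δ - β.ofLp a = -Δ by ring, abs_neg, abs_of_nonneg hΔ0]
    rw [this]
    exact mul_le_mul_of_nonneg_right hxΔ (by linarith)
  -- Each agreeing block costs at most a factor `exp (2n · 2x / m) = p ^ (4τ)` in the cross term.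
  · set S : ℝ := (p : ℝ) ^ (4 * τ) with hS
    have hS0 : 0 < S := Real.rpow_pos_of_pos hp0 _
    have hSe : S = Real.exp (2 * n * (2 * x * (m : ℝ)⁻¹)) := by
      rw [hS, Real.rpow_def_of_pos hp0, hx]
      congr 1
      field_simp
      ring
    have hterm : ∀ f g : Fin m → Fin Q,
        ((1 - (√2 * κ) ^ 2 * inner ℝ (d f) (d g))⁻¹) ^ n ≤
          ∏ i, (if f i = g i then S else 1) := by
      intro f g
      have hi1 : (inner ℝ (d f) (d g) : ℝ) ≤ 1 := by
        have := real_inner_le_norm (d f) (d g)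
        rwa [hdn, hdn, mul_one] at this
      have hi0 : 0 ≤ (inner ℝ (d f) (d g) : ℝ) := by
        rw [hdd]
        exact mul_nonneg (by positivity) (Finset.sum_nonneg fun i _ => by split_ifs <;> norm_num)
      rw [hr]
      refine (inv_one_sub_pow_le_exp (by positivity) (by nlinarith) n).trans (le_of_eq ?_)
      rw [hdd, hSe]
      have e1 : ∀ i, (if f i = g i then Real.exp (2 * n * (2 * x * (m : ℝ)⁻¹)) else 1) =
          Real.exp (2 * n * (2 * x * (m : ℝ)⁻¹) * if f i = g i then 1 else 0) := by
        intro i; split_ifs <;> simp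
      simp_rw [e1]
      rw [← Real.exp_sum, ← Finset.mul_sum]
      congr 1
      ring
    calc _ ≤ ∑ f : Fin m → Fin Q, ∑ g : Fin m → Fin Q, ∏ i, (if f i = g i then S else 1) :=
          Finset.sum_le_sum fun f _ => Finset.sum_le_sum fun g _ => hterm f g
      _ = (Q : ℝ) ^ m * (Q - 1 + S) ^ m := sum_sum_prod_agreement S
      _ ≤ (Q : ℝ) ^ m * (Q * Real.exp (S / Q)) ^ m := by
          gcongr
          have h1 := Real.add_one_le_exp (S / Q)
          have h2 : Q * (S / Q + 1) ≤ Q * Real.exp (S / Q) :=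
            mul_le_mul_of_nonneg_left h1 hQ0.le
          have h3 : Q * (S / Q + 1) = S + Q := by field_simp
          linarith
      _ = Real.exp (m * S / Q) * ((Q : ℝ) ^ m) ^ 2 := by
          rw [mul_pow, ← Real.exp_nat_mul, mul_div_assoc]
          ring
      _ ≤ _ := by
          rw [Fintype.card_fun, Fintype.card_fin, Fintype.card_fin, Nat.cast_pow]
          gcongr

/-! ### Large and small dimensions -/

theorem exists_dimension_threshold {c γ δ : ℝ} (hγ₁ : γ < 1 / 2) (hδ : 0 < δ) :
    ∃ p₀ : ℕ, ∀ p : ℕ, p₀ ≤ p → c * (p : ℝ) ^ γ ≤ p / 8 ∧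
      4 * c ^ 2 * (p : ℝ) ^ (-((1 - 2 * γ) / 2)) ≤ δ := by
  have h1 := ((tendsto_rpow_neg_atTop (show 0 < 1 - γ by linarith)).comp
    tendsto_natCast_atTop_atTop).const_mul c
  have h2 := ((tendsto_rpow_neg_atTop (show 0 < (1 - 2 * γ) / 2 by linarith)).comp
    tendsto_natCast_atTop_atTop).const_mul (4 * c ^ 2)
  rw [mul_zero] at h1 h2
  have h3 := h1.eventually_le_const (show (0 : ℝ) < 1 / 8 by norm_num)
  have h4 := h2.eventually_le_const hδ
  obtain ⟨p₀, hp₀⟩ := Filter.eventually_atTop.1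
    ((h3.and h4).and (Filter.eventually_ge_atTop 1))
  refine ⟨p₀, fun p hp => ?_⟩
  obtain ⟨⟨h5, h6⟩, h7⟩ := hp₀ p hp
  refine ⟨?_, h6⟩
  have hp0 : (0 : ℝ) < p := by exact_mod_cast h7
  have h8 : (p : ℝ) ^ γ = (p : ℝ) ^ (-(1 - γ)) * p := by
    rw [← Real.rpow_add_one hp0.ne']
    congr 1
    ring
  simp only [Function.comp_apply] at h5
  rw [h8, ← mul_assoc]
  nlinarith

/-- As `m ≤ p / 8`, the blocks still cover `m Q ≥ p / 4` coordinates. The chi-square exponent is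
then at most `4 m² p^(4τ) / p`, and `m² ≤ c² p^(2γ)` leaves the exponent `-(1 - 2γ)/2` after half of
the gap `1 - 2γ` is spent on `p^(4τ)`. -/
theorem block_count_bounds {p k m : ℕ} {c γ τ δ : ℝ} (hp : 2 ≤ p) (hm : 1 ≤ m)
    (hmk : m ≤ k) (hk : (k : ℝ) ≤ c * (p : ℝ) ^ γ) (hkp : c * (p : ℝ) ^ γ ≤ p / 8)
    (hτ : 4 * τ ≤ (1 - 2 * γ) / 2)
    (hδ : 4 * c ^ 2 * (p : ℝ) ^ (-((1 - 2 * γ) / 2)) ≤ δ) :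
    1 ≤ (p - 1) / m ∧ m * (p : ℝ) ^ (4 * τ) / ((p - 1) / m : ℕ) ≤ δ := by
  have hp2 : (2 : ℝ) ≤ p := by exact_mod_cast hp
  have hp0 : (0 : ℝ) < p := by linarith
  have hm0 : (0 : ℝ) < m := by exact_mod_cast hm
  have hmk' : (m : ℝ) ≤ c * (p : ℝ) ^ γ := le_trans (by exact_mod_cast hmk) hk
  set Q := (p - 1) / m with hQ
  have hlt : p - 1 < m * (Q + 1) := Nat.lt_mul_div_succ _ (by omega)
  have hlt' : (p : ℝ) ≤ m * (Q + 1) := by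
    exact_mod_cast (by omega : p ≤ m * (Q + 1))
  have hmQ : (p : ℝ) / 4 ≤ m * Q := by linarith
  have hQ0 : (0 : ℝ) < Q := by
    by_contra h
    have : m * (Q : ℝ) ≤ 0 := mul_nonpos_of_nonneg_of_nonpos hm0.le (not_lt.1 h)
    linarith
  refine ⟨by exact_mod_cast hQ0, le_trans ?_ hδ⟩
  have h1 : (p : ℝ) ^ (4 * τ) ≤ (p : ℝ) ^ ((1 - 2 * γ) / 2) :=
    Real.rpow_le_rpow_of_exponent_le (by linarith) hτ
  have h2 : (m : ℝ) ^ 2 ≤ (c * (p : ℝ) ^ γ) ^ 2 := pow_le_pow_left₀ hm0.le hmk' 2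
  have h3 : ((p : ℝ) ^ γ) ^ 2 * (p : ℝ) ^ ((1 - 2 * γ) / 2) =
      (p : ℝ) ^ (-((1 - 2 * γ) / 2)) * p := by
    rw [← Real.rpow_natCast, ← Real.rpow_mul hp0.le, ← Real.rpow_add hp0,
      ← Real.rpow_add_one hp0.ne']
    congr 1
    push_cast
    ring
  rw [div_le_iff₀ hQ0]
  refine le_of_mul_le_mul_left ?_ hm0
  calc m * (m * (p : ℝ) ^ (4 * τ)) = (m : ℝ) ^ 2 * (p : ℝ) ^ (4 * τ) := by ring
    _ ≤ (c * (p : ℝ) ^ γ) ^ 2 * (p : ℝ) ^ ((1 - 2 * γ) / 2) := by gcongr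
    _ = c ^ 2 * (((p : ℝ) ^ γ) ^ 2 * (p : ℝ) ^ ((1 - 2 * γ) / 2)) := by ring
    _ = 4 * c ^ 2 * (p : ℝ) ^ (-((1 - 2 * γ) / 2)) * (p / 4) := by rw [h3]; ring
    _ ≤ 4 * c ^ 2 * (p : ℝ) ^ (-((1 - 2 * γ) / 2)) * (m * Q) := by gcongr
    _ = _ := by ring

theorem sparse_rate_le_of_dimension_le {n p k p₀ : ℕ} {c γ : ℝ} (hn : 1 ≤ n) (hp : 2 ≤ p)
    (hpp : p ≤ p₀) (hc : 0 < c) (hγ : γ ≤ 1) (hk : (k : ℝ) ≤ c * (p : ℝ) ^ γ) :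
    k * (Real.log p / n) ≤ c * (p₀ : ℝ) ^ 2 * (1 / √(n : ℝ)) := by
  have hn1 : (1 : ℝ) ≤ n := by exact_mod_cast hn
  have hp1 : (1 : ℝ) ≤ p := by exact_mod_cast (by omega : 1 ≤ p)
  have hpp' : (p : ℝ) ≤ p₀ := by exact_mod_cast hpp
  have h1 : (p : ℝ) ^ γ ≤ p := by
    simpa using Real.rpow_le_rpow_of_exponent_le hp1 hγ
  have h2 : Real.log p ≤ p := (Real.log_le_sub_one_of_pos (by linarith)).trans (by linarith)
  have h3 : √(n : ℝ) ≤ n := by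
    rw [Real.sqrt_le_left (by linarith)]; nlinarith
  have h4 : 0 ≤ Real.log p := Real.log_nonneg hp1
  have h5 : 0 < √(n : ℝ) := Real.sqrt_pos.2 (by linarith)
  calc k * (Real.log p / n) ≤ (c * p₀) * (p₀ / √(n : ℝ)) := by
        gcongr
        · exact hk.trans (mul_le_mul_of_nonneg_left (h1.trans hpp') hc.le)
        · exact h2.trans hpp'
    _ = _ := by ring

end HDRegression

/-! ### Choice of constants and assembly -/

theorem corollary1 (α : ℝ) (hα₀ : 0 < α) (hα₁ : α < 1 / 2)
    (M₁ : ℝ) (hM₁ : 1 < M₁) (M₂ : ℝ) (hM₂ : 0 < M₂)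
    (c : ℝ) (hc : 0 < c) (γ : ℝ) (hγ₀ : 0 ≤ γ) (hγ₁ : γ < 1 / 2)
    (ζ₀ : ℝ) (hζ₀ : 0 < ζ₀) (hζ₁ : ζ₀ < 1) :
    ∃ c₁ : ℝ, 0 < c₁ ∧
      ∀ (n p k k₁ : ℕ) (_hn : 1 ≤ n) (hp : 2 ≤ p),
        (k : ℝ) ≤ c * min ((p : ℝ) ^ γ) ((n : ℝ) / Real.log p) →
        (k₁ : ℝ) ≤ (1 - ζ₀) * k - 1 →
        ∀ θ : HDRegression.Param p, θ ∈ HDRegression.paramSpace p M₁ M₂ k₁ → θ.Ω = 1 →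
          ENNReal.ofReal (c₁ * (1 / √(n : ℝ) + k * (Real.log p / n)) * θ.σ) ≤
            ⨅ CI ∈ HDRegression.confidenceIntervals n α (HDRegression.paramSpace p M₁ M₂ k)
                (fun β => β ⟨0, by omega⟩),
              HDRegression.expectedLength CI θ := by
  set η : ℝ := (1 - 2 * α) / 2 with hη
  have hη0 : 0 < η := by rw [hη]; linarith
  set δ : ℝ := Real.log (1 + η ^ 2) with hδ
  have hδ0 : 0 < δ := Real.log_pos (by nlinarith)
  have hexpδ : Real.exp δ = 1 + η ^ 2 := Real.exp_log (by positivity)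
  -- The two entries give `r² ≤ 1/2`, needed for `1/(1 - x) ≤ exp (2x)`, and `exp (2t²) ≤ 1 + η²`.
  set t : ℝ := √(min (1 / 2) (δ / 2)) with ht
  have htpos : 0 < t := Real.sqrt_pos.2 (lt_min (by norm_num) (by linarith))
  have ht2 : t ^ 2 = min (1 / 2) (δ / 2) := Real.sq_sqrt (le_min (by norm_num) (by linarith))
  have hMM : 0 < 1 - 1 / M₁ := by
    rw [sub_pos, div_lt_one (by linarith)]; exact hM₁
  -- Since `m log p / n ≤ c`, the first two entries bound `κ²` by `1/8` and by `(1 - 1/M₁)²`, the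
  -- latter keeping the spectrum of `Ω` admissible; the third controls the factor `p ^ (4τ)`.
  set τ : ℝ := min (min (1 / (8 * c)) ((1 - 1 / M₁) ^ 2 / c)) ((1 - 2 * γ) / 8) with hτ
  have hτ0 : 0 < τ := lt_min (lt_min (by positivity) (by positivity)) (by linarith)
  have hτ1 : τ * c ≤ 1 / 8 := by
    have h : τ ≤ 1 / (8 * c) := (min_le_left _ _).trans (min_le_left _ _)
    rw [le_div_iff₀ (by positivity)] at h
    linarith
  have hτ2 : τ * c ≤ (1 - 1 / M₁) ^ 2 := by
    have h : τ ≤ (1 - 1 / M₁) ^ 2 / c := (min_le_left _ _).trans (min_le_right _ _)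
    rwa [le_div_iff₀ hc] at h
  have hτ3 : 4 * τ ≤ (1 - 2 * γ) / 2 := by
    have h : τ ≤ (1 - 2 * γ) / 8 := min_le_right _ _
    linarith
  obtain ⟨p₀, hp₀⟩ := HDRegression.exists_dimension_threshold (c := c) hγ₁ hδ0
  -- The first entry serves `p < p₀`, where the parametric bound alone suffices. The other two serve
  -- `p ≥ p₀`; their halves bound a sum of two rates by a maximum.
  set c₁ : ℝ := min (t * η / (1 + c * (p₀ : ℝ) ^ 2)) (min (t * η / 2) (τ * ζ₀ * η / 2)) with hc₁
  refine ⟨c₁, lt_min (by positivity) (lt_min (by positivity) (by positivity)), ?_⟩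
  intro n p k k₁ hn hp hk hk₁ θ hθ hΩ
  refine le_iInf₂ fun CI hCI => ?_
  have hn0 : (0 : ℝ) < n := by exact_mod_cast hn
  have hp1 : (1 : ℝ) < p := by exact_mod_cast (by omega : 1 < p)
  have hlog : 0 < Real.log p := Real.log_pos hp1
  have hσ : 0 < θ.σ := hθ.2.2.1
  have hkγ : (k : ℝ) ≤ c * (p : ℝ) ^ γ := hk.trans (by gcongr; exact min_le_left _ _)
  have hkn : (k : ℝ) * (Real.log p / n) ≤ c := by
    have h : (k : ℝ) ≤ c * (n / Real.log p) := hk.trans (by gcongr; exact min_le_right _ _)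
    calc (k : ℝ) * (Real.log p / n) ≤ c * (n / Real.log p) * (Real.log p / n) := by gcongr
      _ = c := by field_simp
  have hζk : ζ₀ * k ≤ k - k₁ - 1 := by linarith
  have hkk' : (k₁ : ℝ) + 1 ≤ k := by
    have : 0 ≤ ζ₀ * k := by positivity
    linarith
  have hkk : k₁ + 1 ≤ k := by exact_mod_cast hkk'
  have hkpos : (0 : ℝ) < k := by
    have : (0 : ℝ) ≤ k₁ := Nat.cast_nonneg _
    linarith
  have hpar := HDRegression.ofReal_le_expectedLength_parametric hn hα₁ htpos.le
    (ht2.le.trans (min_le_left _ _)) (by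
      rw [← hη, ← hexpδ]
      refine Real.exp_le_exp.2 ?_
      have : t ^ 2 ≤ δ / 2 := ht2.le.trans (min_le_right _ _)
      linarith) hkk _ hCI hθ hΩ
  rw [← hη] at hpar
  set R : ℝ := k * (Real.log p / n) with hR
  have hR0 : 0 < R := by positivity
  have hs0 : 0 < 1 / √(n : ℝ) := one_div_pos.2 (Real.sqrt_pos.2 hn0)
  have htn : t / √(n : ℝ) = t * (1 / √(n : ℝ)) := by ring
  rw [htn] at hpar
  have hsmall : p ≤ p₀ → R ≤ c * (p₀ : ℝ) ^ 2 * (1 / √(n : ℝ)) := fun h =>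
    HDRegression.sparse_rate_le_of_dimension_le hn hp h hc (by linarith) hkγ
  generalize 1 / √(n : ℝ) = N at *
  rcases lt_or_ge p p₀ with hlt | hge
  · refine le_trans (ENNReal.ofReal_le_ofReal ?_) hpar
    have hKN := hsmall hlt.le
    have hK : 0 < 1 + c * (p₀ : ℝ) ^ 2 := by positivity
    have h1 : c₁ * (1 + c * (p₀ : ℝ) ^ 2) ≤ t * η := by
      have h : c₁ ≤ t * η / (1 + c * (p₀ : ℝ) ^ 2) := min_le_left _ _
      rwa [le_div_iff₀ hK] at h
    have hc₁0 : 0 < c₁ := lt_min (by positivity) (lt_min (by positivity) (by positivity))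
    calc c₁ * (N + R) * θ.σ ≤ c₁ * (N + c * (p₀ : ℝ) ^ 2 * N) * θ.σ := by gcongr
      _ = c₁ * (1 + c * (p₀ : ℝ) ^ 2) * N * θ.σ := by ring
      _ ≤ t * η * N * θ.σ := by gcongr
      _ = _ := by ring
  · obtain ⟨hp₁, hp₂⟩ := hp₀ p hge
    -- Of the `k - k₁` nonzero entries to spare, one goes to the target coordinate and `m` to the
    -- hidden direction. The `-1` in the hypothesis on `k₁` gives `m ≥ ζ₀ k > 0`.
    obtain ⟨m, rfl⟩ : ∃ m, k = k₁ + (m + 1) := ⟨k - k₁ - 1, by omega⟩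
    have hmζ : ζ₀ * ((k₁ + (m + 1) : ℕ) : ℝ) ≤ m := by
      push_cast at hζk ⊢
      linarith
    have hm0 : (0 : ℝ) < m := lt_of_lt_of_le (by positivity) hmζ
    have hm : 1 ≤ m := by exact_mod_cast hm0
    obtain ⟨hQ, hQδ⟩ := HDRegression.block_count_bounds hp hm (by omega) hkγ hp₁ hτ3 hp₂
    have hmR : (m : ℝ) * (Real.log p / n) ≤ c := by
      refine le_trans ?_ hkn
      rw [hR]
      gcongr
      omega
    have hmτ : τ * ((m : ℝ) * (Real.log p / n)) ≤ τ * c := by gcongr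
    have hsp := HDRegression.ofReal_le_expectedLength_sparse hn hα₁ hM₁ hτ0 hp hm hQ
      (Nat.mul_div_le _ _) le_rfl (hmτ.trans hτ1) (hmτ.trans hτ2) (by
        rw [← hη, ← hexpδ]
        exact Real.exp_le_exp.2 hQδ) hCI hθ hΩ
    rw [← hη] at hsp
    have hRm : ζ₀ * R ≤ m * (Real.log p / n) := by
      rw [hR, ← mul_assoc]
      gcongr
    have h1 : c₁ ≤ t * η / 2 := (min_le_right _ _).trans (min_le_left _ _)
    have h2 : c₁ ≤ τ * ζ₀ * η / 2 := (min_le_right _ _).trans (min_le_right _ _)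
    have h3 : c₁ * (N + R) * θ.σ ≤
        max (θ.σ * (t * N) * η) (θ.σ * (τ * (m * (Real.log p / n))) * η) := by
      have e1 : c₁ * N * θ.σ ≤ t * η / 2 * N * θ.σ := by gcongr
      have e2 : c₁ * R * θ.σ ≤ τ * ζ₀ * η / 2 * R * θ.σ := by gcongr
      have e3 : θ.σ * (τ * (ζ₀ * R)) * η ≤ θ.σ * (τ * (m * (Real.log p / n))) * η := by gcongr
      have e4 := le_max_left (θ.σ * (t * N) * η) (θ.σ * (τ * (m * (Real.log p / n))) * η)
      have e5 := le_max_right (θ.σ * (t * N) * η) (θ.σ * (τ * (m * (Real.log p / n))) * η)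
      linarith
    refine le_trans (ENNReal.ofReal_le_ofReal h3) ?_
    rcases max_choice (θ.σ * (t * N) * η) (θ.σ * (τ * (m * (Real.log p / n))) * η) with h | h
    · rw [h]; exact hpar
    · rw [h]; exact hsp
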